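/- Let $F$ be Thompson's group: the group, under composition $(fg)(x)=f(g(x))$, of the piecewise linear orientation-preserving homeomorphisms of $[0,1]$ whose finitely many breakpoints have dyadic rational coordinates and whose slopes are powers of $2$. Let $x_0\in F$ be the piecewise linear map with vertices $(0,0),(\tfrac12,\tfrac14),(\tfrac34,\tfrac12),(1,1)$, let $x_1\in F$ be the one with vertices $(0,0),(\tfrac12,\tfrac12),(\tfrac34,\tfrac58),(\tfrac78,\tfrac34),(1,1)$, and let $x_{n+1}=x_0^{-n}x_1x_0^{n}$ for $n\ge 1$. Let $\mathcal G_3$ be the space of groups marked by an ordered triple of generators, up to isomorphism of marked groups, with the topology of the metric for which two marked groups are at distance at most $e^{-R}$ ($R\in\mathbb N$) if and only if they have the same relations of length at most $R$ (distances being $0$ or of the form $e^{-R}$, $R \in \mathbb N$). Let $(t_n)$ be a sequence in $[0,1)$ with $\lim_{n\to\infty}t_n=1$, and for each $n$ let $w_n=w_n(a,b)$ be a word in $a^{\pm1},b^{\pm1}$ such that the element $w_n(x_0,x_1)$ of $F$ has support contained in $[t_n,1]$ and maps $\left[\frac{3+t_n}{4},1\right]$ linearly (that is, by an affine map) onto $\left[\frac{1+t_n}{2},1\right]$.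 Put $$G_n=\langle a,b,c \mid R_1=[ba^{-1},a^{-1}ba],\ R_2=[ba^{-1},a^{-2}ba^{2}],\ c^{-1}w_n(a,b)\rangle .$$ Then the sequence $(G_n,\{a,b,c\})$ converges in $\mathcal G_3$ to $(G,\{a,b,c\})$, where $$G=\langle a,b,c \mid R_1,\ R_2,\ R_3=[ca^{-1},a^{-1}ca],\ R_4=[ca^{-1},a^{-2}ca^{2}],\ [ba^{-1},a^{i}ca^{-i}]\ \text{for all } i\in\mathbb Z\rangle .$$ The hypotheses on the elements $w_n(x_0,x_1)$ are satisfied, for example, by $x_n$ (the value at $(x_0,x_1)$ of the word $a$ for $n=0$ and $a^{-(n-1)}ba^{n-1}$ for $n\ge1$) with $t_n=1-2^{-n}$, for every $n\ge 0$. -/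

import Mathlib

open Filter Topology
open scoped commutatorElement

namespace ThompsonLimit

/-! ### Thompson's group `F` -/

/-- Dyadic rational numbers. -/
def IsDyadic (x : ℝ) : Prop := ∃ (m : ℤ) (k : ℕ), x = m / 2 ^ k

theorem IsDyadic.add {x y : ℝ} (hx : IsDyadic x) (hy : IsDyadic y) : IsDyadic (x + y) := by
  obtain ⟨m, k, rfl⟩ := hx
  obtain ⟨n, l, rfl⟩ := hy
  refine ⟨m * 2 ^ l + n * 2 ^ k, k + l, ?_⟩
  push_cast
  rw [pow_add]
  field_simp

theorem IsDyadic.sub {x y : ℝ} (hx : IsDyadic x) (hy : IsDyadic y) : IsDyadic (x - y) := by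
  obtain ⟨m, k, rfl⟩ := hx
  obtain ⟨n, l, rfl⟩ := hy
  refine ⟨m * 2 ^ l - n * 2 ^ k, k + l, ?_⟩
  push_cast
  rw [pow_add]
  field_simp

theorem IsDyadic.zpow_mul {x : ℝ} (hx : IsDyadic x) (k : ℤ) : IsDyadic (2 ^ k * x) := by
  obtain ⟨m, l, rfl⟩ := hx
  obtain ⟨n, rfl | rfl⟩ := k.eq_nat_or_neg
  · refine ⟨m * 2 ^ n, l, ?_⟩
    push_cast
    rw [zpow_natCast]
    ring
  · refine ⟨m, n + l, ?_⟩
    rw [zpow_neg, zpow_natCast, pow_add]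
    field_simp

/-- `f` is piecewise linear for a finite subdivision `S` of `[0,1]` whose vertices `(p, f p)`
have dyadic coordinates, and every linear piece has slope a power of `2`. (An order isomorphism
of `[0,1]` is the same thing as an orientation-preserving homeomorphism of `[0,1]`.) -/
def IsDyadicPL (f : unitInterval ≃o unitInterval) : Prop :=
  ∃ S : Finset unitInterval, 0 ∈ S ∧ 1 ∈ S ∧
    (∀ p ∈ S, IsDyadic (p : ℝ) ∧ IsDyadic (f p : ℝ)) ∧
    ∀ x y : unitInterval, x < y → (∀ p ∈ S, p ≤ x ∨ y ≤ p) →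
      ∃ k : ℤ, ∀ u ∈ Set.Icc x y, ∀ v ∈ Set.Icc x y,
        (f v : ℝ) - (f u : ℝ) = 2 ^ k * ((v : ℝ) - (u : ℝ))

theorem IsDyadicPL.map_dyadic {f : unitInterval ≃o unitInterval} (hf : IsDyadicPL f)
    {x : unitInterval} (hx : IsDyadic (x : ℝ)) : IsDyadic (f x : ℝ) := by
  obtain ⟨S, h0, -, hS, hl⟩ := hf
  have hne : (S.filter (· ≤ x)).Nonempty := ⟨0, by simp [h0]⟩
  obtain ⟨hpS, hpx⟩ := Finset.mem_filter.1 ((S.filter (· ≤ x)).max'_mem hne)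
  have hmax : ∀ q ∈ S, q ≤ x → q ≤ (S.filter (· ≤ x)).max' hne := fun q hq hqx =>
    Finset.le_max' _ _ (Finset.mem_filter.2 ⟨hq, hqx⟩)
  generalize (S.filter (· ≤ x)).max' hne = p at hpS hpx hmax
  rcases hpx.eq_or_lt with rfl | hlt
  · exact (hS p hpS).2
  · obtain ⟨k, hk⟩ := hl p x hlt (fun q hq => by
      rcases le_total q x with h | h
      · exact Or.inl (hmax q hq h)
      · exact Or.inr h)
    have h := hk p ⟨le_rfl, hpx⟩ x ⟨hpx, le_rfl⟩
    have e : (f x : ℝ) = 2 ^ k * ((x : ℝ) - p) + f p := by linarith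
    rw [e]
    exact ((hx.sub (hS p hpS).1).zpow_mul k).add (hS p hpS).2

theorem IsDyadicPL.one : IsDyadicPL 1 := by
  refine ⟨{0, 1}, by simp, by simp, ?_, fun x y _ _ => ⟨0, fun u _ v _ => by simp⟩⟩
  intro p hp
  rcases Finset.mem_insert.1 hp with rfl | hp
  · exact ⟨⟨0, 0, by simp⟩, ⟨0, 0, by simp⟩⟩
  · rw [Finset.mem_singleton.1 hp]
    exact ⟨⟨1, 0, by simp⟩, ⟨1, 0, by simp⟩⟩

theorem IsDyadicPL.inv {f : unitInterval ≃o unitInterval} (hf : IsDyadicPL f) :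
    IsDyadicPL f⁻¹ := by
  obtain ⟨S, h0, h1, hS, hl⟩ := hf
  have hfi : ∀ x, f (f⁻¹ x) = x := fun x => f.apply_symm_apply x
  have hif : ∀ x, f⁻¹ (f x) = x := fun x => f.symm_apply_apply x
  refine ⟨S.image f, Finset.mem_image.2 ⟨0, h0, f.map_bot⟩,
    Finset.mem_image.2 ⟨1, h1, f.map_top⟩, ?_, ?_⟩
  · intro p hp
    obtain ⟨q, hq, rfl⟩ := Finset.mem_image.1 hp
    rw [hif]
    exact ⟨(hS q hq).2, (hS q hq).1⟩
  · intro x y hxy hp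
    obtain ⟨k, hk⟩ := hl (f⁻¹ x) (f⁻¹ y) (f.symm.lt_iff_lt.2 hxy) (fun p hpS => by
      rcases hp (f p) (Finset.mem_image_of_mem _ hpS) with h | h
      · left; rw [← hif p]; exact f.symm.le_iff_le.2 h
      · right; rw [← hif p]; exact f.symm.le_iff_le.2 h)
    refine ⟨-k, fun u hu v hv => ?_⟩
    have h := hk (f⁻¹ u) ⟨f.symm.le_iff_le.2 hu.1, f.symm.le_iff_le.2 hu.2⟩
      (f⁻¹ v) ⟨f.symm.le_iff_le.2 hv.1, f.symm.le_iff_le.2 hv.2⟩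
    rw [hfi, hfi] at h
    rw [h, zpow_neg, inv_mul_cancel_left₀ (by positivity)]

theorem IsDyadicPL.mul {f g : unitInterval ≃o unitInterval} (hf : IsDyadicPL f)
    (hg : IsDyadicPL g) : IsDyadicPL (f * g) := by
  have hgi : ∀ x, g (g⁻¹ x) = x := fun x => g.apply_symm_apply x
  have hig : ∀ x, g⁻¹ (g x) = x := fun x => g.symm_apply_apply x
  have hf' := hf
  have hg' := hg
  obtain ⟨S, -, -, hS, hl⟩ := hf
  obtain ⟨T, h0, h1, hT, hm⟩ := hg
  refine ⟨T ∪ S.image ⇑g⁻¹, Finset.mem_union_left _ h0, Finset.mem_union_left _ h1, ?_, ?_⟩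
  · intro p hp
    rcases Finset.mem_union.1 hp with hp | hp
    · exact ⟨(hT p hp).1, hf'.map_dyadic (hT p hp).2⟩
    · obtain ⟨q, hq, rfl⟩ := Finset.mem_image.1 hp
      refine ⟨hg'.inv.map_dyadic (hS q hq).1, ?_⟩
      rw [RelIso.mul_apply, hgi]
      exact (hS q hq).2
  · intro x y hxy hp
    obtain ⟨k, hk⟩ := hm x y hxy (fun p hpT => hp p (Finset.mem_union_left _ hpT))
    obtain ⟨l, hl⟩ := hl (g x) (g y) (g.lt_iff_lt.2 hxy) (fun p hpS => by
      rcases hp (g⁻¹ p) (Finset.mem_union_right _ (Finset.mem_image_of_mem _ hpS)) with h | h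
      · left; rw [← hgi p]; exact g.le_iff_le.2 h
      · right; rw [← hgi p]; exact g.le_iff_le.2 h)
    refine ⟨l + k, fun u hu v hv => ?_⟩
    have h := hl (g u) ⟨g.le_iff_le.2 hu.1, g.le_iff_le.2 hu.2⟩
      (g v) ⟨g.le_iff_le.2 hv.1, g.le_iff_le.2 hv.2⟩
    rw [RelIso.mul_apply, RelIso.mul_apply, h, hk u hu v hv, zpow_add₀ two_ne_zero, mul_assoc]

/-- Thompson's group `F`; multiplication is composition, `(f * g) x = f (g x)`. -/
def thompsonF : Subgroup (unitInterval ≃o unitInterval) where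
  carrier := {f | IsDyadicPL f}
  mul_mem' := IsDyadicPL.mul
  one_mem' := IsDyadicPL.one
  inv_mem' := IsDyadicPL.inv

/-- The piecewise linear map through `(0,0)`, `(1/2,1/4)`, `(3/4,1/2)`, `(1,1)`. -/
noncomputable def x0Fun (x : ℝ) : ℝ :=
  if x ≤ 1 / 2 then x / 2 else if x ≤ 3 / 4 then x - 1 / 4 else 2 * x - 1

/-- The inverse of `x0Fun`. -/
noncomputable def x0Inv (x : ℝ) : ℝ :=
  if x ≤ 1 / 4 then 2 * x else if x ≤ 1 / 2 then x + 1 / 4 else (x + 1) / 2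

/-- The piecewise linear map through `(0,0)`, `(1/2,1/2)`, `(3/4,5/8)`, `(7/8,3/4)`, `(1,1)`. -/
noncomputable def x1Fun (x : ℝ) : ℝ :=
  if x ≤ 1 / 2 then x else if x ≤ 3 / 4 then x / 2 + 1 / 4
  else if x ≤ 7 / 8 then x - 1 / 8 else 2 * x - 1

/-- The inverse of `x1Fun`. -/
noncomputable def x1Inv (x : ℝ) : ℝ :=
  if x ≤ 1 / 2 then x else if x ≤ 5 / 8 then 2 * x - 1 / 2
  else if x ≤ 3 / 4 then x + 1 / 8 else (x + 1) / 2

/-- `x0Fun` as an orientation-preserving homeomorphism of `[0,1]`. -/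
noncomputable def x0Iso : unitInterval ≃o unitInterval where
  toFun x := ⟨x0Fun x, by
    have h0 := x.2.1; have h1 := x.2.2
    unfold x0Fun; constructor <;> split_ifs <;> linarith⟩
  invFun x := ⟨x0Inv x, by
    have h0 := x.2.1; have h1 := x.2.2
    unfold x0Inv; constructor <;> split_ifs <;> linarith⟩
  left_inv x := by
    apply Subtype.ext
    simp only [x0Inv, x0Fun]
    split_ifs <;> linarith
  right_inv x := by
    apply Subtype.ext
    simp only [x0Inv, x0Fun]
    split_ifs <;> linarith
  map_rel_iff' := by
    intro x y
    simp only [Equiv.coe_fn_mk, x0Fun, ← Subtype.coe_le_coe]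
    split_ifs <;> constructor <;> intro h <;> linarith

/-- `x1Fun` as an orientation-preserving homeomorphism of `[0,1]`. -/
noncomputable def x1Iso : unitInterval ≃o unitInterval where
  toFun x := ⟨x1Fun x, by
    have h0 := x.2.1; have h1 := x.2.2
    unfold x1Fun; constructor <;> split_ifs <;> linarith⟩
  invFun x := ⟨x1Inv x, by
    have h0 := x.2.1; have h1 := x.2.2
    unfold x1Inv; constructor <;> split_ifs <;> linarith⟩
  left_inv x := by
    apply Subtype.ext
    simp only [x1Inv, x1Fun]
    split_ifs <;> linarith
  right_inv x := by
    apply Subtype.ext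
    simp only [x1Inv, x1Fun]
    split_ifs <;> linarith
  map_rel_iff' := by
    intro x y
    simp only [Equiv.coe_fn_mk, x1Fun, ← Subtype.coe_le_coe]
    split_ifs <;> constructor <;> intro h <;> linarith

theorem x0Iso_apply (x : unitInterval) : (x0Iso x : ℝ) = x0Fun x := rfl

theorem x1Iso_apply (x : unitInterval) : (x1Iso x : ℝ) = x1Fun x := rfl

theorem x0Iso_mem : x0Iso ∈ thompsonF := by
  have hm1 : (0 : ℝ) ≤ 1 / 2 ∧ (1 / 2 : ℝ) ≤ 1 := by norm_num
  have hm2 : (0 : ℝ) ≤ 3 / 4 ∧ (3 / 4 : ℝ) ≤ 1 := by norm_num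
  refine ⟨{0, ⟨1 / 2, hm1⟩, ⟨3 / 4, hm2⟩, 1}, by simp, by simp, ?_, ?_⟩
  · intro p hp
    simp only [Finset.mem_insert, Finset.mem_singleton] at hp
    rw [x0Iso_apply]
    rcases hp with rfl | rfl | rfl | rfl
    · exact ⟨⟨0, 0, by simp⟩, ⟨0, 0, by norm_num [x0Fun]⟩⟩
    · exact ⟨⟨1, 1, by norm_num⟩, ⟨1, 2, by norm_num [x0Fun]⟩⟩
    · exact ⟨⟨3, 2, by norm_num⟩, ⟨1, 1, by norm_num [x0Fun]⟩⟩
    · exact ⟨⟨1, 0, by simp⟩, ⟨1, 0, by norm_num [x0Fun]⟩⟩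
  · intro x y hxy hp
    have h1 := hp ⟨1 / 2, hm1⟩ (by simp)
    have h2 := hp ⟨3 / 4, hm2⟩ (by simp)
    simp only [← Subtype.coe_le_coe] at h1 h2
    rcases h1 with h1 | h1
    · rcases h2 with h2 | h2
      · refine ⟨1, fun u hu v hv => ?_⟩
        have := Subtype.coe_le_coe.2 hu.1; have := Subtype.coe_le_coe.2 hv.1
        rw [x0Iso_apply, x0Iso_apply, zpow_one]
        unfold x0Fun
        split_ifs <;> linarith
      · refine ⟨0, fun u hu v hv => ?_⟩
        have := Subtype.coe_le_coe.2 hu.1; have := Subtype.coe_le_coe.2 hv.1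
        have := Subtype.coe_le_coe.2 hu.2; have := Subtype.coe_le_coe.2 hv.2
        rw [x0Iso_apply, x0Iso_apply, zpow_zero]
        unfold x0Fun
        split_ifs <;> linarith
    · refine ⟨-1, fun u hu v hv => ?_⟩
      have := Subtype.coe_le_coe.2 hu.2; have := Subtype.coe_le_coe.2 hv.2
      rw [x0Iso_apply, x0Iso_apply, zpow_neg_one]
      unfold x0Fun
      split_ifs <;> linarith

theorem x1Iso_mem : x1Iso ∈ thompsonF := by
  have hm1 : (0 : ℝ) ≤ 1 / 2 ∧ (1 / 2 : ℝ) ≤ 1 := by norm_num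
  have hm2 : (0 : ℝ) ≤ 3 / 4 ∧ (3 / 4 : ℝ) ≤ 1 := by norm_num
  have hm3 : (0 : ℝ) ≤ 7 / 8 ∧ (7 / 8 : ℝ) ≤ 1 := by norm_num
  refine ⟨{0, ⟨1 / 2, hm1⟩, ⟨3 / 4, hm2⟩, ⟨7 / 8, hm3⟩, 1}, by simp, by simp, ?_, ?_⟩
  · intro p hp
    simp only [Finset.mem_insert, Finset.mem_singleton] at hp
    rw [x1Iso_apply]
    rcases hp with rfl | rfl | rfl | rfl | rfl
    · exact ⟨⟨0, 0, by simp⟩, ⟨0, 0, by norm_num [x1Fun]⟩⟩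
    · exact ⟨⟨1, 1, by norm_num⟩, ⟨1, 1, by norm_num [x1Fun]⟩⟩
    · exact ⟨⟨3, 2, by norm_num⟩, ⟨5, 3, by norm_num [x1Fun]⟩⟩
    · exact ⟨⟨7, 3, by norm_num⟩, ⟨3, 2, by norm_num [x1Fun]⟩⟩
    · exact ⟨⟨1, 0, by simp⟩, ⟨1, 0, by norm_num [x1Fun]⟩⟩
  · intro x y hxy hp
    have h1 := hp ⟨1 / 2, hm1⟩ (by simp)
    have h2 := hp ⟨3 / 4, hm2⟩ (by simp)
    have h3 := hp ⟨7 / 8, hm3⟩ (by simp)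
    simp only [← Subtype.coe_le_coe] at h1 h2 h3
    rcases h3 with h3 | h3
    · refine ⟨1, fun u hu v hv => ?_⟩
      have := Subtype.coe_le_coe.2 hu.1; have := Subtype.coe_le_coe.2 hv.1
      rw [x1Iso_apply, x1Iso_apply, zpow_one]
      unfold x1Fun
      split_ifs <;> linarith
    · rcases h2 with h2 | h2
      · refine ⟨0, fun u hu v hv => ?_⟩
        have := Subtype.coe_le_coe.2 hu.1; have := Subtype.coe_le_coe.2 hv.1
        have := Subtype.coe_le_coe.2 hu.2; have := Subtype.coe_le_coe.2 hv.2
        rw [x1Iso_apply, x1Iso_apply, zpow_zero]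
        unfold x1Fun
        split_ifs <;> linarith
      · rcases h1 with h1 | h1
        · refine ⟨-1, fun u hu v hv => ?_⟩
          have := Subtype.coe_le_coe.2 hu.1; have := Subtype.coe_le_coe.2 hv.1
          have := Subtype.coe_le_coe.2 hu.2; have := Subtype.coe_le_coe.2 hv.2
          rw [x1Iso_apply, x1Iso_apply, zpow_neg_one]
          unfold x1Fun
          split_ifs <;> linarith
        · refine ⟨0, fun u hu v hv => ?_⟩
          have := Subtype.coe_le_coe.2 hu.2; have := Subtype.coe_le_coe.2 hv.2
          rw [x1Iso_apply, x1Iso_apply, zpow_zero, x1Fun, x1Fun, if_pos (by linarith),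
            if_pos (by linarith), one_mul]

/-- The generator `x₀` of `F`. -/
noncomputable def x0 : thompsonF := ⟨x0Iso, x0Iso_mem⟩

/-- The generator `x₁` of `F`. -/
noncomputable def x1 : thompsonF := ⟨x1Iso, x1Iso_mem⟩

/-- The element `w(x₀, x₁)` of `F` represented by a word `w` in two letters. -/
noncomputable def evalF : FreeGroup (Fin 2) →* thompsonF := FreeGroup.lift ![x0, x1]

/-- The word for the generator `x_n` of the infinite presentation of `F`:
`x_{n+1} = x₀⁻ⁿ x₁ x₀ⁿ`. -/
def xWord : ℕ → FreeGroup (Fin 2)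
  | 0 => FreeGroup.of 0
  | n + 1 => (FreeGroup.of 0 ^ n)⁻¹ * FreeGroup.of 1 * FreeGroup.of 0 ^ n

/-- The support of `f` is contained in the closed interval `[p, q]`. -/
def SupportedIn (f : thompsonF) (p q : ℝ) : Prop :=
  ∀ x : unitInterval, f.1 x ≠ x → (x : ℝ) ∈ Set.Icc p q

/-- `f` maps the interval `[p, q]` linearly (that is, by an affine map) onto `[r, s]`. -/
def MapsLinearlyOnto (f : thompsonF) (p q r s : ℝ) : Prop :=
  (fun x : unitInterval => (f.1 x : ℝ)) '' {x | (x : ℝ) ∈ Set.Icc p q} = Set.Icc r s ∧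
    ∃ m d : ℝ, ∀ x : unitInterval, (x : ℝ) ∈ Set.Icc p q → (f.1 x : ℝ) = m * x + d

/-! ### The space of marked groups -/

/-- A group with an ordered `k`-tuple of generators. -/
structure MarkedGroup (k : ℕ) where
  carrier : Type
  [group : Group carrier]
  gens : Fin k → carrier
  closure_gens : Subgroup.closure (Set.range gens) = ⊤

attribute [instance] MarkedGroup.group

/-- The canonical epimorphism from the free group. -/
def MarkedGroup.canonical {k : ℕ} (M : MarkedGroup k) : FreeGroup (Fin k) →* M.carrier :=
  FreeGroup.lift M.gens

theorem MarkedGroup.canonical_surjective {k : ℕ} (M : MarkedGroup k) :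
    Function.Surjective M.canonical := by
  rw [← MonoidHom.range_eq_top, MarkedGroup.canonical, FreeGroup.range_lift_eq_closure]
  exact M.closure_gens

/-- Isomorphism of marked groups. -/
def MarkedGroup.Isom {k : ℕ} (M N : MarkedGroup k) : Prop :=
  ∃ φ : M.carrier ≃* N.carrier, ∀ i, φ (M.gens i) = N.gens i

theorem MarkedGroup.isom_iff {k : ℕ} (M N : MarkedGroup k) :
    M.Isom N ↔ M.canonical.ker = N.canonical.ker := by
  constructor
  · rintro ⟨φ, hφ⟩
    have h : φ.toMonoidHom.comp M.canonical = N.canonical := by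
      ext i
      simp [MarkedGroup.canonical, hφ]
    ext w
    rw [MonoidHom.mem_ker, MonoidHom.mem_ker, ← h]
    simp
  · intro h
    let e₁ := QuotientGroup.quotientKerEquivOfSurjective _ M.canonical_surjective
    let e₂ := QuotientGroup.quotientKerEquivOfSurjective _ N.canonical_surjective
    refine ⟨(e₁.symm.trans (QuotientGroup.quotientMulEquivOfEq h)).trans e₂, fun i => ?_⟩
    have h1 : M.gens i = e₁ (QuotientGroup.mk (FreeGroup.of i)) := by
      change _ = M.canonical (FreeGroup.of i)
      simp [MarkedGroup.canonical]
    have h2 : N.gens i = e₂ (QuotientGroup.mk (FreeGroup.of i)) := by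
      change _ = N.canonical (FreeGroup.of i)
      simp [MarkedGroup.canonical]
    rw [h1, h2]
    simp

/-- Isomorphism of marked groups as a setoid. -/
instance MarkedGroup.setoid (k : ℕ) : Setoid (MarkedGroup k) where
  r := MarkedGroup.Isom
  iseqv :=
    { refl := fun M => (M.isom_iff M).2 rfl
      symm := fun {M N} h => (N.isom_iff M).2 ((M.isom_iff N).1 h).symm
      trans := fun {M N P} h h' =>
        (M.isom_iff P).2 (((M.isom_iff N).1 h).trans ((N.isom_iff P).1 h')) }

/-- The set of groups marked by `k` elements, up to isomorphism of marked groups. -/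
def MarkedGroups (k : ℕ) : Type 1 := Quotient (MarkedGroup.setoid k)

/-- The relations of a marked group: the words that are trivial in it. -/
def MarkedGroups.relations {k : ℕ} : MarkedGroups k → Subgroup (FreeGroup (Fin k)) :=
  Quotient.lift (fun M => M.canonical.ker) fun M N h => (M.isom_iff N).1 h

theorem MarkedGroups.relations_injective {k : ℕ} :
    Function.Injective (MarkedGroups.relations (k := k)) := by
  rintro ⟨M⟩ ⟨N⟩ h
  exact Quotient.sound ((M.isom_iff N).2 h)

/-- Two marked groups have the same relations of length at most `R`. -/
def MarkedGroups.Agree {k : ℕ} (R : ℕ) (A B : MarkedGroups k) : Prop :=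
  ∀ w : FreeGroup (Fin k), w.norm ≤ R → (w ∈ A.relations ↔ w ∈ B.relations)

/-- The distance is the infimum of the numbers `e^{-R}` over all `R` such that the two marked
groups have the same relations of length at most `R`. -/
noncomputable instance MarkedGroups.instDist (k : ℕ) : Dist (MarkedGroups k) where
  dist A B := sInf {ε : ℝ | ∃ R : ℕ, MarkedGroups.Agree R A B ∧ ε = Real.exp (-R)}

theorem MarkedGroups.dist_le_exp_iff {k : ℕ} (A B : MarkedGroups k) (R : ℕ) :
    dist A B ≤ Real.exp (-R) ↔ MarkedGroups.Agree R A B := by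
  have hbdd : BddBelow {ε : ℝ | ∃ R : ℕ, MarkedGroups.Agree R A B ∧ ε = Real.exp (-R)} :=
    ⟨0, by rintro _ ⟨R, -, rfl⟩; positivity⟩
  have hne : {ε : ℝ | ∃ R : ℕ, MarkedGroups.Agree R A B ∧ ε = Real.exp (-R)}.Nonempty := by
    refine ⟨_, 0, fun w hw => ?_, rfl⟩
    rw [FreeGroup.norm_eq_zero.1 (Nat.le_zero.1 hw)]
    simp [one_mem]
  constructor
  · intro h
    by_contra hR
    cases R with
    | zero =>
      exact hR fun w hw => by
        rw [FreeGroup.norm_eq_zero.1 (Nat.le_zero.1 hw)]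
        simp [one_mem]
    | succ R =>
      have hle : Real.exp (-(R : ℝ)) ≤ dist A B := by
        refine le_csInf hne ?_
        rintro _ ⟨R', hR', rfl⟩
        refine Real.exp_le_exp.2 (neg_le_neg (Nat.cast_le.2 ?_))
        by_contra hlt
        exact hR fun w hw => hR' w (hw.trans (by omega))
      have : Real.exp (-((R + 1 : ℕ) : ℝ)) < Real.exp (-(R : ℝ)) :=
        Real.exp_lt_exp.2 (by push_cast; linarith)
      linarith
  · intro h
    exact csInf_le hbdd ⟨R, h, rfl⟩

theorem MarkedGroups.dist_nonneg' {k : ℕ} (A B : MarkedGroups k) : 0 ≤ dist A B :=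
  Real.sInf_nonneg (by rintro _ ⟨R, -, rfl⟩; positivity)

theorem MarkedGroups.dist_comm' {k : ℕ} (A B : MarkedGroups k) : dist A B = dist B A := by
  have h : ∀ R, MarkedGroups.Agree R A B ↔ MarkedGroups.Agree R B A := fun R =>
    ⟨fun h w hw => (h w hw).symm, fun h w hw => (h w hw).symm⟩
  simp only [dist, h]

theorem MarkedGroups.eq_or_dist {k : ℕ} (A B : MarkedGroups k) :
    A = B ∨ ∃ R : ℕ, dist A B = Real.exp (-R) := by
  by_cases hall : ∀ R, MarkedGroups.Agree R A B
  · left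
    apply MarkedGroups.relations_injective
    ext w
    exact hall w.norm w le_rfl
  · right
    push Not at hall
    classical
    have hfind := Nat.find_spec hall
    have hmin : ∀ m, m < Nat.find hall → MarkedGroups.Agree m A B := fun m hm =>
      not_not.1 (Nat.find_min hall hm)
    generalize Nat.find hall = N at hfind hmin
    cases N with
    | zero =>
      refine absurd (fun w hw => ?_) hfind
      rw [FreeGroup.norm_eq_zero.1 (Nat.le_zero.1 hw)]
      simp [one_mem]
    | succ N =>
      refine ⟨N, le_antisymm ((MarkedGroups.dist_le_exp_iff A B N).2 (hmin N (by omega))) ?_⟩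
      refine le_csInf ⟨_, N, hmin N (by omega), rfl⟩ ?_
      rintro _ ⟨R', hR', rfl⟩
      refine Real.exp_le_exp.2 (neg_le_neg (Nat.cast_le.2 ?_))
      by_contra hlt
      exact hfind fun w hw => hR' w (hw.trans (by omega))

theorem MarkedGroups.dist_self' {k : ℕ} (A : MarkedGroups k) : dist A A = 0 := by
  refine le_antisymm ?_ (MarkedGroups.dist_nonneg' A A)
  have h : Tendsto (fun R : ℕ => Real.exp (-(R : ℝ))) atTop (𝓝 0) :=
    Real.tendsto_exp_neg_atTop_nhds_zero.comp tendsto_natCast_atTop_atTop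
  exact ge_of_tendsto' h fun R => (MarkedGroups.dist_le_exp_iff A A R).2 fun _ _ => Iff.rfl

theorem MarkedGroups.dist_triangle' {k : ℕ} (A B C : MarkedGroups k) :
    dist A C ≤ dist A B + dist B C := by
  have hAB := MarkedGroups.dist_nonneg' A B
  have hBC := MarkedGroups.dist_nonneg' B C
  rcases MarkedGroups.eq_or_dist A B with rfl | ⟨R, hR⟩
  · linarith
  rcases MarkedGroups.eq_or_dist B C with rfl | ⟨R', hR'⟩
  · linarith
  have h1 := (MarkedGroups.dist_le_exp_iff A B R).1 hR.le
  have h2 := (MarkedGroups.dist_le_exp_iff B C R').1 hR'.le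
  have h3 : dist A C ≤ Real.exp (-((min R R' : ℕ) : ℝ)) :=
    (MarkedGroups.dist_le_exp_iff A C _).2 fun w hw =>
      (h1 w (hw.trans (min_le_left _ _))).trans (h2 w (hw.trans (min_le_right _ _)))
  rcases min_choice R R' with h | h <;> rw [h] at h3 <;> linarith

/-- The metric (hence the topology) on the space of marked groups. -/
noncomputable instance MarkedGroups.instMetricSpace (k : ℕ) : MetricSpace (MarkedGroups k) where
  dist_self := MarkedGroups.dist_self'
  dist_comm := MarkedGroups.dist_comm'
  dist_triangle := MarkedGroups.dist_triangle'
  eq_of_dist_eq_zero := by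
    intro A B h
    rcases MarkedGroups.eq_or_dist A B with hAB | ⟨R, hR⟩
    · exact hAB
    · exact absurd (hR.symm.trans h) (Real.exp_ne_zero _)

/-! ### The presentations -/

/-- The group given by a presentation with `k` generators, marked by these generators. -/
def markedPresentation {k : ℕ} (rels : Set (FreeGroup (Fin k))) : MarkedGroups k :=
  Quotient.mk (MarkedGroup.setoid k)
    { carrier := PresentedGroup rels
      gens := PresentedGroup.of
      closure_gens := PresentedGroup.closure_range_of rels }

/-- The letter `a`. -/
def a : FreeGroup (Fin 3) := FreeGroup.of 0

/-- The letter `b`. -/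
def b : FreeGroup (Fin 3) := FreeGroup.of 1

/-- The letter `c`. -/
def c : FreeGroup (Fin 3) := FreeGroup.of 2

/-- `R₁ = [b a⁻¹, a⁻¹ b a]` -/
def R₁ : FreeGroup (Fin 3) := ⁅b * a⁻¹, a⁻¹ * b * a⁆

/-- `R₂ = [b a⁻¹, a⁻² b a²]` -/
def R₂ : FreeGroup (Fin 3) := ⁅b * a⁻¹, a ^ (-2 : ℤ) * b * a ^ (2 : ℤ)⁆

/-- `R₃ = [c a⁻¹, a⁻¹ c a]` -/
def R₃ : FreeGroup (Fin 3) := ⁅c * a⁻¹, a⁻¹ * c * a⁆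

/-- `R₄ = [c a⁻¹, a⁻² c a²]` -/
def R₄ : FreeGroup (Fin 3) := ⁅c * a⁻¹, a ^ (-2 : ℤ) * c * a ^ (2 : ℤ)⁆

/-- The word `w(a, b)`. -/
def wordAB (w : FreeGroup (Fin 2)) : FreeGroup (Fin 3) := FreeGroup.lift ![a, b] w

/-- The marked group `⟨a, b, c | R₁, R₂, c⁻¹ w(a, b)⟩`. -/
def groupOfWord (w : FreeGroup (Fin 2)) : MarkedGroups 3 :=
  markedPresentation {R₁, R₂, c⁻¹ * wordAB w}

/-- The marked group `⟨a, b, c | R₁, R₂, R₃, R₄, [b a⁻¹, aⁱ c a⁻ⁱ] (i ∈ ℤ)⟩`. -/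
def limitGroup : MarkedGroups 3 :=
  markedPresentation
    ({R₁, R₂, R₃, R₄} ∪ Set.range fun i : ℤ => ⁅b * a⁻¹, a ^ i * c * a ^ (-i)⁆)

end ThompsonLimit

/-! The engine is a rigidity statement. In any group, two elements satisfying `R₁`, `R₂` generate a
group of fractions: every element is a product of positive words, their inverses and powers of `a`.
If such a pair acts suitably on a linear order, the exponents of the positive words can be read off
from the action, so the pair has no relations beyond the consequences of `R₁`, `R₂`
(`ThompsonPair.eq_one_of_map_eq_one`). Applied to `(x0, x1)`, this identifies `Gₙ` with the subgroup
of `F` marked by `x0`, `x1`, `wₙ`; it applies equally to `(x0, wₙ)` for large `n`.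

Each relator of the limit holds in `Gₙ` for large `n`, because supports become disjoint. Conversely,
suppose `u` is trivial in infinitely many `Gₙ`. Since `wₙ` tends pointwise to the identity, `u` is
trivial at `(x0, x1, 1)` (`eventually_evalAt_apply`). In the limit group the conjugates `aⁱ c a⁻ⁱ`
generate a normal subgroup whose quotient is governed by `(a, b)`, so `u` equals some `v(a, c)`
(`exists_lift_ac`). Then `v(x0, wₙ) = 1` for some large `n`, and rigidity of `(x0, wₙ)` transfers
this to `v(a, c) = 1` in the limit. -/

namespace ThompsonLimit

/-! ### Fractions in groups satisfying the relations of `F` -/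

section Fractions

variable {G : Type*} [Group G]

/-- `a⁻ʲ b aʲ`, the generator `x_{j+1}` of the infinite presentation of `F`. -/
def conjGen (a b : G) (j : ℕ) : G := (a ^ j)⁻¹ * b * a ^ j

theorem conjGen_zero (a b : G) : conjGen a b 0 = b := by simp [conjGen]

theorem conjGen_succ (a b : G) (j : ℕ) : conjGen a b (j + 1) = a⁻¹ * conjGen a b j * a := by
  simp only [conjGen, pow_succ, mul_inv_rev, mul_assoc]

theorem conjGen_add (a b : G) (i j : ℕ) :
    conjGen a b (i + j) = (a ^ i)⁻¹ * conjGen a b j * a ^ i := by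
  rw [add_comm]
  simp only [conjGen, pow_add, mul_inv_rev, mul_assoc]

/-- The two defining relations of `F`. -/
structure ThompsonPair (a b : G) : Prop where
  commute_one : Commute (b * a⁻¹) (a⁻¹ * b * a)
  commute_two : Commute (b * a⁻¹) (a ^ (-2 : ℤ) * b * a ^ (2 : ℤ))

/-- The submonoid generated by the elements `a⁻ʲ b aʲ`. -/
def conjMonoid (a b : G) : Submonoid G := Submonoid.closure (Set.range (conjGen a b))

theorem conjGen_mem (a b : G) (j : ℕ) : conjGen a b j ∈ conjMonoid a b :=
  Submonoid.subset_closure ⟨j, rfl⟩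

theorem conj_mem_conjMonoid {a b t : G} (ht : t ∈ conjMonoid a b) :
    a⁻¹ * t * a ∈ conjMonoid a b := by
  induction ht using Submonoid.closure_induction with
  | mem x hx =>
    obtain ⟨j, rfl⟩ := hx
    rw [← conjGen_succ]
    exact conjGen_mem a b _
  | one => simp [one_mem]
  | mul x y _ _ hx hy =>
    have := mul_mem hx hy
    convert this using 1
    group

/-- The element `b^{e₀} · a⁻¹ b^{e₁} a · a⁻² b^{e₂} a² ⋯`. -/
def hornerProd (a b : G) : List ℕ → G
  | [] => 1
  | e :: l => b ^ e * (a⁻¹ * hornerProd a b l * a)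

/-! ### Infinite presentation, normal forms of positive words, and fractions. -/

namespace ThompsonPair

variable {a b : G} (h : ThompsonPair a b)
include h

/-- By `commute_one`, conjugation by `b` and by `a` agree on `a⁻¹ b a`. Hence each later generator
is the conjugate of its predecessor by the one before that, and the centralizer of `b a⁻¹`, once it
contains two consecutive generators, contains all that follow. -/
theorem commute_conjGen : ∀ m : ℕ, Commute (b * a⁻¹) (conjGen a b (m + 1))
  | 0 => by simpa [conjGen] using h.commute_one
  | 1 => by
    have h2 := h.commute_two
    have e : conjGen a b (1 + 1) = a ^ (-2 : ℤ) * b * a ^ (2 : ℤ) := by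
      simp only [conjGen]; group
    rwa [e]
  | m + 2 => by
    have h1 := commute_conjGen m
    have h2 := commute_conjGen (m + 1)
    have e : conjGen a b (m + 2 + 1)
        = (conjGen a b (m + 1))⁻¹ * conjGen a b (m + 1 + 1) * conjGen a b (m + 1) := by
      have key : b * (a⁻¹ * (a⁻¹ * b * a) * a) = a⁻¹ * b * a * b := by
        have := h.commute_one.eq
        have h3 := congrArg (· * a) this
        simp only [mul_assoc, inv_mul_cancel, mul_one] at h3 ⊢
        exact h3
      have key' : conjGen a b 2 = b⁻¹ * (a⁻¹ * b * a) * b := by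
        rw [conjGen_succ, conjGen_succ, conjGen_zero, mul_assoc b⁻¹, ← key,
          inv_mul_cancel_left]
      rw [show m + 2 + 1 = (m + 1) + 2 by ring, conjGen_add, key', conjGen_add a b (m + 1) 1,
        conjGen_succ a b 0, conjGen_zero, conjGen]
      group
    rw [e]
    exact (h1.inv_right.mul_right h2).mul_right h1

theorem conjGen_mul_base (m : ℕ) : conjGen a b (m + 1) * b = b * conjGen a b (m + 2) := by
  have := congrArg (· * a) (h.commute_conjGen m).eq
  rw [conjGen_succ a b (m + 1)]
  simp only [mul_assoc, inv_mul_cancel, mul_one] at this ⊢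
  exact this.symm

theorem conjGen_mul_conjGen {k m : ℕ} (hkm : k < m) :
    conjGen a b m * conjGen a b k = conjGen a b k * conjGen a b (m + 1) := by
  obtain ⟨d, rfl⟩ := Nat.exists_eq_add_of_lt hkm
  have := congrArg (fun z => (a ^ k)⁻¹ * z * a ^ k) (h.conjGen_mul_base d)
  rw [add_assoc, add_assoc, conjGen_add a b k (d + 1), conjGen_add a b k (d + 1 + 1)]
  rw [show conjGen a b k = (a ^ k)⁻¹ * b * a ^ k from rfl]
  simp only [mul_assoc, mul_inv_cancel_left] at this ⊢
  exact this

theorem conjGen_mul_pow (j e : ℕ) :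
    conjGen a b (j + 1) * b ^ e = b ^ e * conjGen a b (j + e + 1) := by
  induction e generalizing j with
  | zero => simp
  | succ e ih =>
    rw [pow_succ', ← mul_assoc, h.conjGen_mul_base, mul_assoc, ih, mul_assoc,
      show j + 1 + e + 1 = j + (e + 1) + 1 by ring]

/-- A generator either raises the leading exponent (`j = 0`) or crosses the leading power of `b`,
its index growing by the exponent, and is absorbed by the tail. -/
theorem conjGen_mul_hornerProd (j : ℕ) (l : List ℕ) :
    ∃ l', conjGen a b j * hornerProd a b l = hornerProd a b l' := by
  induction l generalizing j with
  | nil =>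
    refine ⟨List.replicate j 0 ++ [1], ?_⟩
    induction j with
    | zero => simp [hornerProd, conjGen_zero]
    | succ j ih =>
      rw [List.replicate_succ, List.cons_append, hornerProd.eq_2 _ _ 0, ← ih, conjGen_succ]
      simp only [hornerProd, mul_one, pow_zero, one_mul]
  | cons e l ih =>
    cases j with
    | zero => exact ⟨(e + 1) :: l, by simp only [hornerProd, conjGen_zero, pow_succ', mul_assoc]⟩
    | succ j =>
      -- Crossing `b ^ e` raises the index `j + 1` by `e`; the conjugation by `a` around the tail
      -- lowers it by one.
      obtain ⟨l', hl'⟩ := ih (j + e)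
      refine ⟨e :: l', ?_⟩
      rw [hornerProd, hornerProd, ← mul_assoc, h.conjGen_mul_pow, ← hl', conjGen_succ]
      group

theorem exists_hornerProd {t : G} (ht : t ∈ conjMonoid a b) : ∃ l, t = hornerProd a b l := by
  induction ht using Submonoid.closure_induction_left with
  | one => exact ⟨[], rfl⟩
  | mul_left x hx y _ ih =>
    obtain ⟨j, rfl⟩ := hx
    obtain ⟨l, rfl⟩ := ih
    exact h.conjGen_mul_hornerProd j l

/-- An inverse letter meeting a positive letter either cancels or crosses it, one of the two indices
growing by one; hence the induction is over all `j`. -/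
theorem inv_conjGen_mul (j : ℕ) {t : G} (ht : t ∈ conjMonoid a b) :
    ∃ p ∈ conjMonoid a b, ∃ q ∈ conjMonoid a b, (conjGen a b j)⁻¹ * t = p * q⁻¹ := by
  induction ht using Submonoid.closure_induction_left generalizing j with
  | one => exact ⟨1, one_mem _, _, conjGen_mem a b j, by simp⟩
  | mul_left x hx y hy ih =>
    obtain ⟨k, rfl⟩ := hx
    rcases lt_trichotomy j k with hjk | rfl | hjk
    · obtain ⟨p, hp, q, hq, e⟩ := ih j
      refine ⟨conjGen a b (k + 1) * p, mul_mem (conjGen_mem a b _) hp, q, hq, ?_⟩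
      rw [mul_assoc, ← e, inv_mul_eq_iff_eq_mul, ← mul_assoc, ← mul_assoc,
        ← h.conjGen_mul_conjGen hjk]
      group
    · exact ⟨y, hy, 1, one_mem _, by simp⟩
    · obtain ⟨p, hp, q, hq, e⟩ := ih (j + 1)
      refine ⟨conjGen a b k * p, mul_mem (conjGen_mem a b _) hp, q, hq, ?_⟩
      rw [mul_assoc, ← e, inv_mul_eq_iff_eq_mul, ← mul_assoc, ← mul_assoc,
        h.conjGen_mul_conjGen hjk]
      group

theorem exists_fraction {u : G} (hu : u ∈ Subgroup.closure {a, b}) :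
    ∃ (e f : ℕ) (p q : G), p ∈ conjMonoid a b ∧ q ∈ conjMonoid a b ∧
      u = a ^ e * p * q⁻¹ * (a ^ f)⁻¹ := by
  induction hu using Subgroup.closure_induction_left with
  | one => exact ⟨0, 0, 1, 1, one_mem _, one_mem _, by simp⟩
  | mul_left x hx y _ ih =>
    obtain ⟨e, f, p, q, hp, hq, rfl⟩ := ih
    rcases hx with rfl | rfl
    · exact ⟨e + 1, f, p, q, hp, hq, by simp only [pow_succ', mul_assoc]⟩
    · refine ⟨e, f, conjGen a x e * p, q, mul_mem (conjGen_mem _ _ _) hp, hq, ?_⟩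
      simp only [conjGen]; group
  | inv_mul_cancel x hx y _ ih =>
    obtain ⟨e, f, p, q, hp, hq, rfl⟩ := ih
    rcases hx with rfl | rfl
    · cases e with
      | zero =>
        -- With no power of `a` on the left to cancel, `a⁻¹` is moved to the far right by
        -- conjugating `p` and `q`.
        refine ⟨0, f + 1, _, _, conj_mem_conjMonoid hp, conj_mem_conjMonoid hq, ?_⟩
        simp only [pow_succ]; group
      | succ e => exact ⟨e, f, p, q, hp, hq, by simp only [pow_succ']; group⟩
    · obtain ⟨p', hp', q', hq', hpq⟩ := h.inv_conjGen_mul e hp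
      refine ⟨e, f, p', q * q', hp', mul_mem hq hq', ?_⟩
      rw [show a ^ e * p' * (q * q')⁻¹ * (a ^ f)⁻¹ = a ^ e * (p' * q'⁻¹) * q⁻¹ * (a ^ f)⁻¹ by group,
        ← hpq, conjGen]
      group

end ThompsonPair

end Fractions

/-! ### Faithful actions on linear orders -/

section Action

variable {X : Type*} [LinearOrder X]

theorem apply_eq_of_zpow_apply_eq (g : X ≃o X) {k : ℤ} (hk : k ≠ 0) {x : X}
    (hx : (g ^ k) x = x) : g x = x := by
  have hpow : ∀ n : ℕ, n ≠ 0 → (g ^ n) x = x → g x = x := by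
    intro n hn hx
    have hc : ∀ m : ℕ, (g ^ (m + 1)) x = g ((g ^ m) x) := fun m => by
      rw [pow_succ', RelIso.mul_apply]
    rcases lt_trichotomy (g x) x with hlt | heq | hgt
    · have : ∀ m : ℕ, (g ^ (m + 1)) x < x := by
        intro m
        induction m with
        | zero => simpa using hlt
        | succ m ih => rw [hc]; exact (g.lt_iff_lt.2 ih).trans hlt
      obtain ⟨m, rfl⟩ := Nat.exists_eq_succ_of_ne_zero hn
      exact absurd hx (this m).ne
    · exact heq
    · have : ∀ m : ℕ, x < (g ^ (m + 1)) x := by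
        intro m
        induction m with
        | zero => simpa using hgt
        | succ m ih => rw [hc]; exact hgt.trans (g.lt_iff_lt.2 ih)
      obtain ⟨m, rfl⟩ := Nat.exists_eq_succ_of_ne_zero hn
      exact absurd hx (this m).ne'
  obtain ⟨n, rfl | rfl⟩ := k.eq_nat_or_neg
  · exact hpow n (by simpa using hk) (by simpa using hx)
  · refine hpow n (by simpa using hk) ?_
    rw [zpow_neg, zpow_natCast] at hx
    conv_lhs => rw [← hx]
    exact RelIso.apply_inv_self _ _

variable {G : Type*} [Group G]

/-- Positive words act trivially below `s`, as `φ a` only moves points down. A point below `s` moved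
by `φ a` therefore detects the power of `a`, and a point moved by `φ b` that `φ a` sends below `s`
detects the exponents of `b` one at a time. -/
theorem ThompsonPair.eq_one_of_map_eq_one {a b : G} (h : ThompsonPair a b)
    (φ : G →* (X ≃o X)) (hle : ∀ x, φ a x ≤ x) {s : X} (hfix : ∀ x < s, φ b x = x)
    (hb : ∃ x, φ a x < s ∧ φ b x ≠ x) (ha : ∃ x < s, φ a x ≠ x)
    {u : G} (hu : u ∈ Subgroup.closure {a, b}) (hφ : φ u = 1) : u = 1 := by
  have hpow : ∀ (j : ℕ) (x : X), (φ a ^ j) x ≤ x := by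
    intro j
    induction j with
    | zero => intro x; simp
    | succ j ih => intro x; rw [pow_succ, RelIso.mul_apply]; exact (ih _).trans (hle x)
  have hT : ∀ t ∈ conjMonoid a b, ∀ x < s, φ t x = x := by
    intro t ht
    induction ht using Submonoid.closure_induction with
    | mem y hy =>
      obtain ⟨j, rfl⟩ := hy
      intro x hx
      simp only [conjGen, map_mul, map_inv, map_pow, RelIso.mul_apply]
      rw [hfix _ ((hpow j x).trans_lt hx), RelIso.inv_apply_self]
    | one => simp
    | mul y z _ _ hy hz =>
      intro x hx
      rw [map_mul, RelIso.mul_apply, hz x hx, hy x hx]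
  have hH : ∀ l, hornerProd a b l ∈ conjMonoid a b := by
    intro l
    induction l with
    | nil => exact one_mem _
    | cons e l ih =>
      refine mul_mem (pow_mem ?_ e) (conj_mem_conjMonoid ih)
      simpa only [conjGen_zero] using conjGen_mem a b 0
  obtain ⟨x, hxs, hbx⟩ := hb
  have hzpow : ∀ {e f : ℕ}, (φ b ^ e) x = (φ b ^ f) x → e = f := by
    intro e f hef
    by_contra hne
    refine hbx (apply_eq_of_zpow_apply_eq (φ b) (k := (e : ℤ) - f) (by omega) ?_)
    rw [zpow_sub, ← (Commute.zpow_zpow_self (φ b) _ _).inv_left.eq, zpow_natCast, zpow_natCast,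
      RelIso.mul_apply, hef, RelIso.inv_apply_self]
  -- The tail is evaluated at `φ a x < s`, where it acts trivially.
  have hhead : ∀ e l, φ (hornerProd a b (e :: l)) x = (φ b ^ e) x := by
    intro e l
    simp only [hornerProd, map_mul, map_inv, map_pow, RelIso.mul_apply]
    rw [hT _ (hH l) _ hxs, RelIso.inv_apply_self]
  have htail : ∀ e l l', φ (hornerProd a b (e :: l)) = φ (hornerProd a b (e :: l')) →
      φ (hornerProd a b l) = φ (hornerProd a b l') := by
    intro e l l' hl
    simpa [hornerProd] using hl
  -- Exponent lists are determined only up to trailing zeros, so elements are compared rather than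
  -- lists.
  have hnil : hornerProd a b [] = hornerProd a b [0] := by simp [hornerProd]
  have hinj : ∀ l l', φ (hornerProd a b l) = φ (hornerProd a b l') →
      hornerProd a b l = hornerProd a b l' := by
    have hcons : ∀ e l f l', φ (hornerProd a b (e :: l)) = φ (hornerProd a b (f :: l')) →
        (φ (hornerProd a b l) = φ (hornerProd a b l') → hornerProd a b l = hornerProd a b l') →
        hornerProd a b (e :: l) = hornerProd a b (f :: l') := by
      intro e l f l' hl ih
      obtain rfl : e = f := hzpow (by rw [← hhead e l, ← hhead f l', hl])
      rw [hornerProd, hornerProd, ih (htail e l l' hl)]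
    intro l
    induction l with
    | nil =>
      intro l'
      induction l' with
      | nil => intro _; rfl
      | cons f l' ih =>
        intro hl
        rw [hnil] at hl ⊢
        exact hcons _ _ _ _ hl ih
    | cons e l ih =>
      intro l' hl
      cases l' with
      | nil =>
        rw [hnil] at hl ⊢
        exact hcons _ _ _ _ hl (ih _)
      | cons f l' => exact hcons _ _ _ _ hl (ih _)
  obtain ⟨e, f, p, q, hp, hq, rfl⟩ := h.exists_fraction hu
  have hef : φ a ^ e * φ p = φ a ^ f * φ q := by
    simpa [mul_inv_eq_one, mul_inv_eq_iff_eq_mul] using hφ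
  obtain rfl : e = f := by
    by_contra hne
    obtain ⟨z, hzs, haz⟩ := ha
    refine haz (apply_eq_of_zpow_apply_eq (φ a) (k := (e : ℤ) - f) (by omega) ?_)
    have := congrArg (fun g : X ≃o X => g z) hef
    simp only [RelIso.mul_apply] at this
    rw [hT p hp z hzs, hT q hq z hzs] at this
    rw [zpow_sub, ← (Commute.zpow_zpow_self (φ a) _ _).inv_left.eq, zpow_natCast, zpow_natCast,
      RelIso.mul_apply, this, RelIso.inv_apply_self]
  obtain ⟨l, rfl⟩ := h.exists_hornerProd hp
  obtain ⟨l', rfl⟩ := h.exists_hornerProd hq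
  rw [hinj l l' (mul_left_cancel hef)]
  group

end Action

/-- The pair `(a, g)`, `(b, w)` in the product group again satisfies the two relations, and the
projection to the acting factor is injective on the subgroup it generates. -/
theorem eq_one_of_lift_eq_one {X G : Type*} [LinearOrder X] [Group G] {a b : G} {g w : X ≃o X}
    (h : ThompsonPair a b) (h' : ThompsonPair g w) (hle : ∀ x, g x ≤ x) {s : X}
    (hfix : ∀ x < s, w x = x) (hw : ∃ x, g x < s ∧ w x ≠ x) (hg : ∃ x < s, g x ≠ x)
    {v : FreeGroup (Fin 2)} (hv : FreeGroup.lift ![g, w] v = 1) :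
    FreeGroup.lift ![a, b] v = 1 := by
  have hp : ThompsonPair (a, g) (b, w) :=
    ⟨Prod.ext h.commute_one h'.commute_one, Prod.ext h.commute_two h'.commute_two⟩
  have hfst : (MonoidHom.fst G (X ≃o X)).comp (FreeGroup.lift ![(a, g), (b, w)])
      = FreeGroup.lift ![a, b] := by ext i; fin_cases i <;> simp
  have hsnd : (MonoidHom.snd G (X ≃o X)).comp (FreeGroup.lift ![(a, g), (b, w)])
      = FreeGroup.lift ![g, w] := by ext i; fin_cases i <;> simp
  have hmem : FreeGroup.lift ![(a, g), (b, w)] v ∈ Subgroup.closure {(a, g), (b, w)} := by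
    have : FreeGroup.lift ![(a, g), (b, w)] v ∈ (FreeGroup.lift ![(a, g), (b, w)]).range :=
      ⟨v, rfl⟩
    rwa [FreeGroup.range_lift_eq_closure, Matrix.range_cons_cons_empty] at this
  have := hp.eq_one_of_map_eq_one (MonoidHom.snd G (X ≃o X)) hle hfix hw hg hmem
    ((DFunLike.congr_fun hsnd v).trans hv)
  rw [← hfst, MonoidHom.comp_apply, this, map_one]

/-! ### Pairs of homeomorphisms of the interval -/

theorem x0Fun_lt {x : ℝ} (h0 : 0 < x) (h1 : x < 1) : x0Fun x < x := by
  unfold x0Fun; split_ifs <;> linarith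

theorem x0Iso_le (x : unitInterval) : x0Iso x ≤ x := by
  have h0 := x.2.1; have h1 := x.2.2
  rw [← Subtype.coe_le_coe, x0Iso_apply, x0Fun]
  split_ifs <;> linarith

/-- A homeomorphism supported near `1` which satisfies the relations of `F` together with `x₀`
satisfies no others. -/
theorem eq_one_of_lift_x0_eq_one {G : Type*} [Group G] {a b : G} (h : ThompsonPair a b)
    {w : thompsonF} (h' : ThompsonPair x0 w) {t : ℝ} (ht : 0 < t) (hsupp : SupportedIn w t 1)
    (hw : ∃ x, w.1 x ≠ x)
    {v : FreeGroup (Fin 2)} (hv : FreeGroup.lift ![x0, w] v = 1) :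
    FreeGroup.lift ![a, b] v = 1 := by
  set S : Set unitInterval := {x | w.1 x ≠ x} with hS
  have hlow : ∀ x ∈ S, t ≤ x := fun x hx => (hsupp x hx).1
  obtain ⟨x₁, hx₁⟩ := hw
  have hx₁1 : x₁ < 1 := lt_of_le_of_ne x₁.2.2 (by rintro rfl; exact hx₁ w.1.map_top)
  have ht1 : t ≤ 1 := (hlow x₁ hx₁).trans x₁.2.2
  have hts : (⟨t, ht.le, ht1⟩ : unitInterval) ≤ sInf S := le_sInf hlow
  have hs1 : sInf S < 1 := (sInf_le hx₁).trans_lt hx₁1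
  have hs0 : (0 : ℝ) < (sInf S : unitInterval) := ht.trans_le hts
  have hlift : FreeGroup.lift ![x0Iso, w.1] v = 1 := by
    have : thompsonF.subtype.comp (FreeGroup.lift ![x0, w]) = FreeGroup.lift ![x0Iso, w.1] := by
      ext i : 1; fin_cases i <;> simp [x0]
    rw [← this, MonoidHom.comp_apply, hv, map_one]
  have hpair : ThompsonPair x0Iso w.1 :=
    ⟨congrArg Subtype.val h'.commute_one.eq, congrArg Subtype.val h'.commute_two.eq⟩
  -- The threshold is the infimum of the moved points. Since `x0` strictly lowers it, some moved
  -- point lies below its preimage; `t / 2` lies below the support and is moved by `x0`.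
  refine eq_one_of_lift_eq_one h hpair x0Iso_le (s := sInf S) ?_ ?_ ?_ hlift
  · intro x hx
    by_contra hne
    exact absurd (sInf_le (show x ∈ S from hne)) (not_le.2 hx)
  · have : sInf S < x0Iso.symm (sInf S) := by
      rw [← x0Iso.lt_iff_lt, OrderIso.apply_symm_apply, ← Subtype.coe_lt_coe, x0Iso_apply]
      exact x0Fun_lt hs0 hs1
    obtain ⟨x, hxS, hx⟩ := sInf_lt_iff.1 this
    exact ⟨x, (x0Iso.lt_symm_apply).1 hx, hxS⟩
  · refine ⟨⟨t / 2, by linarith, by linarith⟩, lt_of_lt_of_le ?_ hts, ?_⟩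
    · rw [← Subtype.coe_lt_coe]; change t / 2 < t; linarith
    · intro he
      have := congrArg Subtype.val he
      rw [x0Iso_apply] at this
      exact (x0Fun_lt (by linarith) (by linarith)).ne this

theorem commute_of_disjoint {f g : unitInterval ≃o unitInterval} {r : ℝ}
    (hf : ∀ x : unitInterval, r ≤ x → f x = x) (hg : ∀ x : unitInterval, (x : ℝ) < r → g x = x) :
    Commute f g := by
  refine DFunLike.ext _ _ fun x => ?_
  rw [RelIso.mul_apply, RelIso.mul_apply]
  rcases le_or_gt r x with hx | hx
  · rw [hf x hx, hf]
    by_contra! hlt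
    have h1 := hg _ hlt
    have h2 : g x = x := g.injective h1
    rw [h2] at hlt
    linarith
  · rw [hg x hx, hg]
    by_contra! hlt
    have h1 := hf _ hlt
    have h2 : f x = x := f.injective h1
    rw [h2] at hlt
    linarith

theorem coe_x0Iso_of_le {x : unitInterval} (hx : 3 / 4 ≤ (x : ℝ)) : (x0Iso x : ℝ) = 2 * x - 1 := by
  rw [x0Iso_apply, x0Fun]
  split_ifs <;> linarith

/-- If `w` is supported in `[t,1]`, `t ≥ 1/2`, and agrees with `x₀` on `[(3+t)/4,1]`, then `x₀`
and `w` satisfy the relations of `F`. -/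
theorem thompsonPair_of_supportedIn {w : thompsonF} {t : ℝ} (ht : 1 / 2 ≤ t)
    (hsupp : SupportedIn w t 1)
    (hlin : ∀ x : unitInterval, (3 + t) / 4 ≤ (x : ℝ) → (w.1 x : ℝ) = 2 * x - 1) :
    ThompsonPair x0 w := by
  have hwi : ∀ x, x0Iso⁻¹ (x0Iso x) = x := fun x => x0Iso.symm_apply_apply x
  have hfix : ∀ x : unitInterval, (x : ℝ) < t → w.1 x = x := fun x hx => by
    by_contra hne
    exact absurd (hsupp x hne).1 (not_le.2 hx)
  -- On `[(1+t)/2, 1]` the inverse of `x0` lands in `[(3+t)/4, 1]`, where `w` agrees with `x0`.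
  have hleft : ∀ x : unitInterval, (1 + t) / 2 ≤ (x : ℝ) → (w.1 * x0Iso⁻¹) x = x := by
    intro x hx
    rw [RelIso.mul_apply]
    obtain ⟨y, rfl⟩ := x0Iso.surjective x
    rw [hwi]
    have hy : (3 + t) / 4 ≤ (y : ℝ) := by
      rw [x0Iso_apply, x0Fun] at hx
      split_ifs at hx <;> linarith
    apply Subtype.ext
    rw [hlin y hy, coe_x0Iso_of_le (by linarith)]
  -- As `1/2 ≤ t`, the preimage of `t` under `x0` is `(1+t)/2`, so both conjugates of `w` are
  -- supported in `[(1+t)/2, 1]`.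
  have hone : ∀ x : unitInterval, (x : ℝ) < (1 + t) / 2 → (x0Iso x : ℝ) < t := by
    intro x hx
    rw [x0Iso_apply, x0Fun]
    split_ifs <;> linarith
  refine ⟨Subtype.ext (commute_of_disjoint hleft ?_).eq, Subtype.ext (commute_of_disjoint hleft ?_).eq⟩
  · intro x hx
    change (x0Iso⁻¹ * w.1 * x0Iso) x = x
    rw [RelIso.mul_apply, RelIso.mul_apply, hfix _ (hone x hx), hwi]
  · intro x hx
    change (x0Iso ^ (-2 : ℤ) * w.1 * x0Iso ^ (2 : ℤ)) x = x
    rw [RelIso.mul_apply, RelIso.mul_apply, hfix, ← RelIso.mul_apply, ← zpow_add]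
    · simp
    · rw [zpow_two, RelIso.mul_apply]
      exact lt_of_le_of_lt (x0Iso_le _) (hone x hx)

/-- Monotonicity forces the endpoints to correspond, and the target interval is twice as long as the
source. -/
theorem MapsLinearlyOnto.eq_two_mul_sub {f : thompsonF} {t : ℝ} (ht : t ∈ Set.Ico (0 : ℝ) 1)
    (hf : MapsLinearlyOnto f ((3 + t) / 4) 1 ((1 + t) / 2) 1) (x : unitInterval)
    (hx : (3 + t) / 4 ≤ (x : ℝ)) : (f.1 x : ℝ) = 2 * x - 1 := by
  obtain ⟨himg, m, d, hmd⟩ := hf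
  obtain ⟨ht0, ht1⟩ := ht
  have hp : (3 + t) / 4 ∈ Set.Icc (0 : ℝ) 1 := ⟨by linarith, by linarith⟩
  have h1 := hmd 1 ⟨by simp; linarith, le_rfl⟩
  have h2 := hmd ⟨_, hp⟩ ⟨le_rfl, hp.2⟩
  have htop : f.1 1 = 1 := f.1.map_top
  have hbot : (f.1 ⟨_, hp⟩ : ℝ) = (1 + t) / 2 := by
    apply le_antisymm
    · obtain ⟨y, hy, hfy⟩ : (1 + t) / 2 ∈ (fun x : unitInterval => (f.1 x : ℝ)) ''
          {x | (x : ℝ) ∈ Set.Icc ((3 + t) / 4) 1} := by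
        rw [himg]; exact ⟨le_rfl, by linarith⟩
      rw [← hfy]
      exact Subtype.coe_le_coe.2 (f.1.monotone hy.1)
    · have : (f.1 ⟨_, hp⟩ : ℝ) ∈ (fun x : unitInterval => (f.1 x : ℝ)) ''
          {x | (x : ℝ) ∈ Set.Icc ((3 + t) / 4) 1} := ⟨_, ⟨le_rfl, hp.2⟩, rfl⟩
      rw [himg] at this
      exact this.1
  rw [htop] at h1
  rw [hbot] at h2
  simp only [Set.Icc.coe_one, mul_one] at h1
  have hm : m = 2 := by
    have : (1 - t) * (m - 2) = 0 := by linarith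
    rcases mul_eq_zero.1 this with h | h <;> linarith
  rw [hmd x ⟨hx, x.2.2⟩, hm]
  linarith

theorem supportedIn_x1 : SupportedIn x1 (1 / 2) 1 := by
  intro x hx
  refine ⟨?_, x.2.2⟩
  by_contra! hlt
  refine hx (Subtype.ext ?_)
  change x1Fun x = x
  rw [x1Fun, if_pos hlt.le]

theorem thompsonPair_x0_x1 : ThompsonPair x0 x1 := by
  refine thompsonPair_of_supportedIn le_rfl supportedIn_x1 fun x hx => ?_
  change x1Fun x = _
  rw [x1Fun]
  split_ifs <;> linarith

/-- The relations `R₁`, `R₂` present the subgroup of `F` generated by `x₀` and `x₁`. -/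
theorem eq_one_of_evalF_eq_one {G : Type*} [Group G] {a b : G} (h : ThompsonPair a b)
    {v : FreeGroup (Fin 2)} (hv : evalF v = 1) : FreeGroup.lift ![a, b] v = 1 := by
  refine eq_one_of_lift_x0_eq_one h thompsonPair_x0_x1 (by norm_num) supportedIn_x1 ?_ hv
  refine ⟨⟨3 / 4, by norm_num, by norm_num⟩, fun he => ?_⟩
  have : x1Fun (3 / 4) = 3 / 4 := congrArg Subtype.val he
  norm_num [x1Fun] at this

/-! ### The elements `x_n` -/

/-- On `[3/4, 1]` the map `x0` doubles the distance to `1`; the bound keeps the orbit there before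
each application. -/
theorem coe_x0Iso_pow (n : ℕ) {x : unitInterval} (hx : 1 - 1 / 2 ^ (n + 1) ≤ (x : ℝ)) :
    ((x0Iso ^ n) x : ℝ) = 1 - 2 ^ n * (1 - x) := by
  induction n generalizing x with
  | zero => simp
  | succ n ih =>
    have h34 : 3 / 4 ≤ (x : ℝ) := by
      refine le_trans ?_ hx
      have : (1 : ℝ) / 2 ^ (n + 1 + 1) ≤ 1 / 4 := by
        rw [pow_add, pow_add]
        have : (1 : ℝ) ≤ 2 ^ n := one_le_pow₀ (by norm_num)
        rw [div_le_div_iff₀ (by positivity) (by norm_num)]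
        linarith
      linarith
    have e := coe_x0Iso_of_le h34
    rw [pow_succ, RelIso.mul_apply, ih, e]
    · ring
    · rw [e]
      have : (1 : ℝ) / 2 ^ (n + 1) = 2 * (1 / 2 ^ (n + 1 + 1)) := by
        rw [pow_succ _ (n + 1)]; field_simp
      linarith

theorem xWord_spec (n : ℕ) : SupportedIn (evalF (xWord n)) (1 - 1 / 2 ^ n) 1 ∧
    ∀ x : unitInterval, 1 - 1 / 2 ^ (n + 2) ≤ (x : ℝ) →
      ((evalF (xWord n)).1 x : ℝ) = 2 * x - 1 := by
  cases n with
  | zero =>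
    have e : evalF (xWord 0) = x0 := by simp [evalF, xWord]
    rw [e]
    refine ⟨fun x _ => ⟨by simpa using x.2.1, x.2.2⟩, fun x hx => ?_⟩
    exact coe_x0Iso_of_le (by norm_num at hx; linarith)
  | succ n =>
    have e : (evalF (xWord (n + 1))).1 = (x0Iso ^ n)⁻¹ * x1Iso * x0Iso ^ n := by
      simp [evalF, xWord, x0, x1]
    have hinv : ∀ x, (x0Iso ^ n)⁻¹ ((x0Iso ^ n) x) = x := fun x => RelIso.inv_apply_self _ x
    have h2 : (0 : ℝ) < 2 ^ n := by positivity
    have hdiv : ∀ k, (1 : ℝ) / 2 ^ (n + k) = (1 / 2 ^ n) * (1 / 2 ^ k) := fun k => by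
      rw [pow_add]; field_simp
    have h2' : (0 : ℝ) < 1 / 2 ^ n := by positivity
    have hmul : (2 : ℝ) ^ n * (1 / 2 ^ n) = 1 := by field_simp
    constructor
    · intro x hx
      refine ⟨?_, x.2.2⟩
      by_contra! hlt
      refine hx ?_
      rw [e, RelIso.mul_apply, RelIso.mul_apply]
      have hp : (1 : ℝ) - 1 / 2 ^ (n + 1) ∈ Set.Icc (0 : ℝ) 1 := by
        have : (1 : ℝ) / 2 ^ (n + 1) ≤ 1 := by
          rw [div_le_one (by positivity)]; exact one_le_pow₀ (by norm_num)
        exact ⟨by linarith, by linarith [show (0 : ℝ) < 1 / 2 ^ (n + 1) by positivity]⟩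
      have hlt' : ((x0Iso ^ n) x : ℝ) ≤ 1 / 2 := by
        have h3 : (x0Iso ^ n) x ≤ (x0Iso ^ n) ⟨_, hp⟩ := (x0Iso ^ n).monotone hlt.le
        have h4 := coe_x0Iso_pow n (x := ⟨_, hp⟩) le_rfl
        rw [← Subtype.coe_le_coe, h4] at h3
        change _ ≤ 1 - 2 ^ n * (1 - (1 - 1 / 2 ^ (n + 1))) at h3
        have h5 : (2 : ℝ) ^ n * (1 - (1 - 1 / 2 ^ (n + 1))) = 1 / 2 := by
          rw [hdiv]
          linear_combination (1 / 2) * hmul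
        linarith
      have h1 : x1Iso ((x0Iso ^ n) x) = (x0Iso ^ n) x := by
        apply Subtype.ext
        rw [x1Iso_apply, x1Fun, if_pos hlt']
      rw [h1, hinv]
    · intro x hx
      have hx1 := x.2.2
      rw [add_assoc, hdiv] at hx
      norm_num at hx
      -- This is the expected image `2x - 1`, written through the distance to `1`; `x0 ^ n` scales
      -- that distance for both points, and `x1` doubles it on `[7/8, 1]`.
      have hx' : 1 - 2 * (1 - (x : ℝ)) ∈ Set.Icc (0 : ℝ) 1 := by
        have : (1 : ℝ) / 2 ^ n ≤ 1 := by
          rw [div_le_one (by positivity)]; exact one_le_pow₀ (by norm_num)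
        rw [one_div] at this
        exact ⟨by linarith, by linarith⟩
      have ha : ((x0Iso ^ n) x : ℝ) = 1 - 2 ^ n * (1 - x) :=
        coe_x0Iso_pow n (by rw [hdiv]; norm_num; rw [one_div] at h2'; linarith)
      have hb : ((x0Iso ^ n) ⟨_, hx'⟩ : ℝ) = 1 - 2 ^ n * (1 - (1 - 2 * (1 - (x : ℝ)))) :=
        coe_x0Iso_pow n (by
          change _ ≤ 1 - 2 * (1 - (x : ℝ))
          rw [hdiv]; norm_num; rw [one_div] at h2'; linarith)
      have h78 : 7 / 8 ≤ ((x0Iso ^ n) x : ℝ) := by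
        have h3 : (2 : ℝ) ^ n * (1 - x) ≤ 2 ^ n * (1 / 2 ^ n * (1 / 8)) :=
          mul_le_mul_of_nonneg_left (by rw [one_div]; linarith) h2.le
        rw [← mul_assoc, hmul] at h3
        rw [ha]; linarith
      have h1 : x1Iso ((x0Iso ^ n) x) = (x0Iso ^ n) ⟨_, hx'⟩ := by
        apply Subtype.ext
        rw [hb, x1Iso_apply, x1Fun]
        rw [ha] at h78 ⊢
        split_ifs <;> linarith
      rw [e, RelIso.mul_apply, RelIso.mul_apply, h1, hinv]
      ring

theorem mapsLinearlyOnto_of_eq {f : thompsonF} {t : ℝ} (ht : t ∈ Set.Ico (0 : ℝ) 1)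
    (hf : ∀ x : unitInterval, (3 + t) / 4 ≤ (x : ℝ) → (f.1 x : ℝ) = 2 * x - 1) :
    MapsLinearlyOnto f ((3 + t) / 4) 1 ((1 + t) / 2) 1 := by
  refine ⟨Set.ext fun y => ⟨?_, ?_⟩, 2, -1, fun x hx => by rw [hf x hx.1]; ring⟩
  · rintro ⟨x, hx, rfl⟩
    have := hx.1; have := hx.2
    simp only [hf x hx.1]
    constructor <;> linarith
  · rintro ⟨hy1, hy2⟩
    have h0 := ht.1
    refine ⟨⟨(1 + y) / 2, by linarith, by linarith⟩, ⟨?_, ?_⟩, ?_⟩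
    · change _ ≤ (1 + y) / 2; linarith
    · change (1 + y) / 2 ≤ 1; linarith
    · simp only
      rw [hf _ (by change _ ≤ (1 + y) / 2; linarith)]
      change 2 * ((1 + y) / 2) - 1 = y
      ring

theorem xWord_mapsLinearlyOnto (n : ℕ) :
    MapsLinearlyOnto (evalF (xWord n)) ((3 + (1 - 1 / 2 ^ n)) / 4) 1
      ((1 + (1 - 1 / 2 ^ n)) / 2) 1 := by
  refine mapsLinearlyOnto_of_eq ⟨?_, ?_⟩ fun x hx => (xWord_spec n).2 x ?_
  · have : (1 : ℝ) / 2 ^ n ≤ 1 := by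
      rw [div_le_one (by positivity)]; exact one_le_pow₀ (by norm_num)
    linarith
  · have : (0 : ℝ) < 1 / 2 ^ n := by positivity
    linarith
  · have : (1 : ℝ) / 2 ^ (n + 2) = 1 / 2 ^ n / 4 := by rw [pow_add]; field_simp; norm_num
    linarith

/-! ### Relations of the groups `Gₙ` and of the limit group -/

theorem relations_markedPresentation {k : ℕ} (rels : Set (FreeGroup (Fin k))) :
    (markedPresentation rels).relations = Subgroup.normalClosure rels := by
  have h : FreeGroup.lift (PresentedGroup.of (rels := rels)) = PresentedGroup.mk rels := by
    ext i; simp [PresentedGroup.of]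
  change (FreeGroup.lift (PresentedGroup.of (rels := rels))).ker = _
  rw [h]
  exact QuotientGroup.ker_mk' _

/-- Only finitely many words have length at most `R`, so agreement word by word is enough. -/
theorem tendsto_of_eventually_relations {k : ℕ} {A : ℕ → MarkedGroups k} {B : MarkedGroups k}
    (h : ∀ u, ∀ᶠ n in atTop, (u ∈ (A n).relations ↔ u ∈ B.relations)) :
    Tendsto A atTop (𝓝 B) := by
  rw [Metric.tendsto_nhds]
  intro ε hε
  have hexp : Tendsto (fun R : ℕ => Real.exp (-(R : ℝ))) atTop (𝓝 0) :=
    Real.tendsto_exp_neg_atTop_nhds_zero.comp tendsto_natCast_atTop_atTop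
  obtain ⟨R, hR⟩ := (hexp.eventually_lt_const hε).exists
  have hfin : {u : FreeGroup (Fin k) | u.norm ≤ R}.Finite :=
    Set.Finite.of_finite_image ((List.finite_length_le (Fin k × Bool) R).subset (by
      rintro _ ⟨u, hu, rfl⟩; exact hu)) FreeGroup.toWord_injective.injOn
  filter_upwards [(eventually_all_finite hfin).2 fun u _ => h u] with n hn
  exact ((MarkedGroups.dist_le_exp_iff _ _ R).2 hn).trans_lt hR

theorem thompsonPair_map_ab {G : Type*} [Group G] (φ : FreeGroup (Fin 3) →* G) :
    ThompsonPair (φ a) (φ b) ↔ φ R₁ = 1 ∧ φ R₂ = 1 := by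
  simp only [R₁, R₂, map_commutatorElement, commutatorElement_eq_one_iff_commute, map_mul,
    map_inv, map_zpow]
  exact ⟨fun h => ⟨h.1, h.2⟩, fun h => ⟨h.1, h.2⟩⟩

theorem thompsonPair_map_ac {G : Type*} [Group G] (φ : FreeGroup (Fin 3) →* G) :
    ThompsonPair (φ a) (φ c) ↔ φ R₃ = 1 ∧ φ R₄ = 1 := by
  simp only [R₃, R₄, map_commutatorElement, commutatorElement_eq_one_iff_commute, map_mul,
    map_inv, map_zpow]
  exact ⟨fun h => ⟨h.1, h.2⟩, fun h => ⟨h.1, h.2⟩⟩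

/-- Evaluation of words in `a`, `b`, `c` at `x₀`, `x₁` and `w`. -/
noncomputable def evalAt (w : thompsonF) : FreeGroup (Fin 3) →* thompsonF :=
  FreeGroup.lift ![x0, x1, w]

theorem evalAt_a (w : thompsonF) : evalAt w a = x0 := by simp [evalAt, a]

theorem evalAt_b (w : thompsonF) : evalAt w b = x1 := by simp [evalAt, b]

theorem evalAt_c (w : thompsonF) : evalAt w c = w := by simp [evalAt, c]

theorem map_lift {G H : Type*} [Group G] [Group H] (φ : G →* H) (x y : G)
    (v : FreeGroup (Fin 2)) :
    φ (FreeGroup.lift ![x, y] v) = FreeGroup.lift ![φ x, φ y] v := by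
  rw [← MonoidHom.comp_apply]
  congr 1
  ext i; fin_cases i <;> simp

theorem evalAt_R₁_R₂ (w : thompsonF) : evalAt w R₁ = 1 ∧ evalAt w R₂ = 1 := by
  rw [← thompsonPair_map_ab, evalAt_a, evalAt_b]
  exact thompsonPair_x0_x1

/-- `Gₙ` is the group generated by `x₀`, `x₁` and `wₙ(x₀, x₁)`. -/
theorem mem_relations_groupOfWord (w : FreeGroup (Fin 2)) (u : FreeGroup (Fin 3)) :
    u ∈ (groupOfWord w).relations ↔ evalAt (evalF w) u = 1 := by
  rw [groupOfWord, relations_markedPresentation]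
  have hwAB : evalAt (evalF w) (wordAB w) = evalF w := by
    rw [wordAB, map_lift, evalAt_a, evalAt_b, evalF]
  constructor
  · intro hu
    have : Subgroup.normalClosure {R₁, R₂, c⁻¹ * wordAB w} ≤ (evalAt (evalF w)).ker := by
      refine Subgroup.normalClosure_le_normal ?_
      rintro r (rfl | rfl | rfl)
      · exact (evalAt_R₁_R₂ _).1
      · exact (evalAt_R₁_R₂ _).2
      · simp [MonoidHom.mem_ker, hwAB, evalAt_c]
    exact this hu
  · intro hu
    rw [← PresentedGroup.mk_eq_one_iff]
    set π := PresentedGroup.mk {R₁, R₂, c⁻¹ * wordAB w} with hπ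
    have hpair : ThompsonPair (π a) (π b) := by
      rw [thompsonPair_map_ab]
      exact ⟨PresentedGroup.one_of_mem (by simp), PresentedGroup.one_of_mem (by simp)⟩
    have hc : π c = π (wordAB w) := by
      have : π (c⁻¹ * wordAB w) = 1 := PresentedGroup.one_of_mem (by simp)
      rwa [map_mul, map_inv, inv_mul_eq_one] at this
    -- Substituting `w` for `c`: both the presentation map and the evaluation in `F` factor through
    -- `σ`, leaving a question about two-letter words.
    let σ : FreeGroup (Fin 3) →* FreeGroup (Fin 2) :=
      FreeGroup.lift ![FreeGroup.of 0, FreeGroup.of 1, w]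
    have h1 : π = (FreeGroup.lift ![π a, π b]).comp σ := by
      ext i
      fin_cases i
      · simp [σ, a]
      · simp [σ, b]
      · have h3 : σ (FreeGroup.of 2) = w := by simp [σ]
        change π c = FreeGroup.lift ![π a, π b] (σ (FreeGroup.of 2))
        rw [h3, hc]
        exact map_lift π a b w
    have h2 : evalAt (evalF w) = evalF.comp σ := by
      ext i : 1
      fin_cases i <;> simp [σ, evalAt, evalF]
    rw [h1, MonoidHom.comp_apply]
    refine eq_one_of_evalF_eq_one hpair ?_
    rw [← MonoidHom.comp_apply, ← h2, hu]

theorem eventually_mem_of_mem_normalClosure {G H : Type*} [Group G] [Group H] {φ : ℕ → G →* H}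
    {S : Set G} (hS : ∀ r ∈ S, ∀ᶠ n in atTop, φ n r = 1) {u : G}
    (hu : u ∈ Subgroup.normalClosure S) : ∀ᶠ n in atTop, φ n u = 1 := by
  induction hu using Subgroup.closure_induction with
  | mem x hx =>
    obtain ⟨r, hr, hrx⟩ := Group.mem_conjugatesOfSet_iff.1 hx
    obtain ⟨g, rfl⟩ := isConj_iff.1 hrx
    filter_upwards [hS r hr] with n hn
    simp [hn]
  | one => simp
  | mul x y _ _ hx hy =>
    filter_upwards [hx, hy] with n h1 h2
    simp [h1, h2]
  | inv x _ hx =>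
    filter_upwards [hx] with n h1
    simp [h1]

/-- The relators of the limit group. -/
def limitRels : Set (FreeGroup (Fin 3)) :=
  {R₁, R₂, R₃, R₄} ∪ Set.range fun i : ℤ => ⁅b * a⁻¹, a ^ i * c * a ^ (-i)⁆

/-! ### Pointwise limits of evaluations, and the limit relators for large `n`. -/

section Sequence

variable {t : ℕ → ℝ} {w : ℕ → thompsonF}

theorem eventually_apply_eq (ht : Tendsto t atTop (𝓝 1)) (hsupp : ∀ n, SupportedIn (w n) (t n) 1)
    (x : unitInterval) : ∀ᶠ n in atTop, (w n).1 x = x := by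
  rcases x.2.2.eq_or_lt with hx | hx
  · obtain rfl : x = 1 := Subtype.ext hx
    exact .of_forall fun n => (w n).1.map_top
  · filter_upwards [ht.eventually_const_lt hx] with n hn
    by_contra hne
    exact absurd (hsupp n x hne).1 (not_le.2 hn)

/-- Every `x < 1` eventually lies below the support of `wₙ`. In a product, the inner factor
eventually takes a value independent of `n`, at which the outer one can be evaluated. -/
theorem eventually_evalAt_apply (ht : Tendsto t atTop (𝓝 1))
    (hsupp : ∀ n, SupportedIn (w n) (t n) 1) (u : FreeGroup (Fin 3)) (x : unitInterval) :
    ∀ᶠ n in atTop, (evalAt (w n) u).1 x = (evalAt 1 u).1 x := by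
  have hinv : ∀ (f : thompsonF) (x : unitInterval), f⁻¹.1 (f.1 x) = x :=
    fun f x => f.1.symm_apply_apply x
  have hinv' : ∀ (f : thompsonF) (x : unitInterval), f.1 (f⁻¹.1 x) = x :=
    fun f x => f.1.apply_symm_apply x
  have hmul : ∀ (f g : thompsonF) (x : unitInterval), (f * g).1 x = f.1 (g.1 x) :=
    fun f g x => rfl
  have hstep : ∀ u : FreeGroup (Fin 3),
      (∀ x, ∀ᶠ n in atTop, (evalAt (w n) u).1 x = (evalAt 1 u).1 x) →
      ∀ x, ∀ᶠ n in atTop, (evalAt (w n) u⁻¹).1 x = (evalAt 1 u⁻¹).1 x := by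
    intro u hu x
    filter_upwards [hu ((evalAt 1 u⁻¹).1 x)] with n hn
    rw [map_inv, hinv'] at hn
    rw [map_inv, map_inv, ← hinv (evalAt (w n) u) ((evalAt 1 u)⁻¹.1 x), hn]
  have hof : ∀ i x, ∀ᶠ n in atTop,
      (evalAt (w n) (FreeGroup.of i)).1 x = (evalAt 1 (FreeGroup.of i)).1 x := by
    intro i x
    fin_cases i
    · simp [evalAt]
    · simp [evalAt]
    · simpa [evalAt] using eventually_apply_eq ht hsupp x
  induction u using FreeGroup.induction_on generalizing x with
  | C1 => simp
  | of i => exact hof i x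
  | inv_of i _ => exact hstep _ (hof i) x
  | mul u v hu hv =>
    filter_upwards [hv x, hu ((evalAt 1 v).1 x)] with n h1 h2
    rw [map_mul, map_mul, hmul, hmul, h1, h2]

theorem eventually_relator_eq_one (ht : Tendsto t atTop (𝓝 1))
    (hsupp : ∀ n, SupportedIn (w n) (t n) 1)
    (hpair : ∀ᶠ n in atTop, ThompsonPair x0 (w n)) :
    ∀ r ∈ limitRels, ∀ᶠ n in atTop, evalAt (w n) r = 1 := by
  have hac : ∀ᶠ n in atTop, evalAt (w n) R₃ = 1 ∧ evalAt (w n) R₄ = 1 := by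
    filter_upwards [hpair] with n hn
    rwa [← thompsonPair_map_ac, evalAt_a, evalAt_c]
  rintro r ((rfl | rfl | rfl | rfl) | ⟨i, rfl⟩)
  · exact .of_forall fun n => (evalAt_R₁_R₂ _).1
  · exact .of_forall fun n => (evalAt_R₁_R₂ _).2
  · exact hac.mono fun n h => h.1
  · exact hac.mono fun n h => h.2
  -- The maps `x0` and `x1` agree on `[7/8, 1]`, which `x0` carries onto `[3/4, 1]`, so `x1 x0⁻¹` is
  -- trivial there. For fixed `i`, the conjugate of `wₙ` is eventually trivial below `3/4`.
  · set p : unitInterval := ⟨3 / 4, by norm_num, by norm_num⟩ with hp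
    have hlt : (x0Iso ^ (-i)) p < 1 := by
      have h1 : (x0Iso ^ (-i)) 1 = 1 := (x0Iso ^ (-i)).map_top
      rw [← h1, (x0Iso ^ (-i)).lt_iff_lt, ← Subtype.coe_lt_coe]
      norm_num [hp]
    filter_upwards [ht.eventually_const_lt (show ((x0Iso ^ (-i)) p : ℝ) < 1 from hlt)] with n hn
    simp only [map_commutatorElement, commutatorElement_eq_one_iff_commute, map_mul, map_inv,
      map_zpow, evalAt_a, evalAt_b, evalAt_c]
    refine Subtype.ext (commute_of_disjoint (r := 3 / 4) ?_ ?_).eq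
    · intro x hx
      change x1Iso (x0Iso.symm x) = x
      obtain ⟨y, rfl⟩ := x0Iso.surjective x
      rw [OrderIso.symm_apply_apply]
      apply Subtype.ext
      have := y.2.2
      rw [x0Iso_apply] at hx ⊢
      rw [x1Iso_apply]
      rw [x0Fun] at hx ⊢
      rw [x1Fun]
      split_ifs at * <;> linarith
    · intro x hx
      change (x0Iso ^ i) ((w n).1 ((x0Iso ^ (-i)) x)) = x
      have hfix : (w n).1 ((x0Iso ^ (-i)) x) = (x0Iso ^ (-i)) x := by
        by_contra hne
        have h1 := (hsupp n _ hne).1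
        have h2 : (x0Iso ^ (-i)) x ≤ (x0Iso ^ (-i)) p := (x0Iso ^ (-i)).monotone hx.le
        rw [← Subtype.coe_le_coe] at h2
        linarith
      rw [hfix, ← RelIso.mul_apply, ← zpow_add]
      simp

end Sequence

/-! ### The structure of the limit group -/

section Structure

variable {G : Type*} [Group G]

/-- Conjugation by `y`, like conjugation by `x`, shifts the index `i`. Both therefore normalize the
subgroup generated by these conjugates, which can be collected on the left. -/
theorem exists_mul_of_commute {x y z : G} (h : ∀ i : ℤ, Commute (y * x⁻¹) (x ^ i * z * x ^ (-i)))
    {u : G} (hu : u ∈ Subgroup.closure {x, y, z}) :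
    ∃ k ∈ Subgroup.closure (Set.range fun i : ℤ => x ^ i * z * x ^ (-i)),
      ∃ p : FreeGroup (Fin 2), u = k * FreeGroup.lift ![x, y] p := by
  set K := Subgroup.closure (Set.range fun i : ℤ => x ^ i * z * x ^ (-i)) with hK
  have hmem : ∀ i : ℤ, x ^ i * z * x ^ (-i) ∈ K := fun i => Subgroup.subset_closure ⟨i, rfl⟩
  have hconj : ∀ g : G, (∀ i : ℤ, g * (x ^ i * z * x ^ (-i)) * g⁻¹ ∈ K) →
      ∀ k ∈ K, g * k * g⁻¹ ∈ K := by
    intro g hg k hk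
    have : K ≤ K.comap (MulAut.conj g).toMonoidHom := by
      rw [hK, Subgroup.closure_le]
      rintro _ ⟨i, rfl⟩
      exact hg i
    exact this hk
  have hx : ∀ i : ℤ, x * (x ^ i * z * x ^ (-i)) * x⁻¹ = x ^ (i + 1) * z * x ^ (-(i + 1)) :=
    fun i => by group
  have hx' : ∀ i : ℤ, x⁻¹ * (x ^ i * z * x ^ (-i)) * x⁻¹⁻¹
      = x ^ (i - 1) * z * x ^ (-(i - 1)) := fun i => by group
  have hy : ∀ i : ℤ, y * (x ^ i * z * x ^ (-i)) * y⁻¹ = x ^ (i + 1) * z * x ^ (-(i + 1)) := by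
    intro i
    have h1 := (h (i + 1)).eq
    rw [← hx] at h1
    rw [← hx, mul_inv_eq_iff_eq_mul]
    calc y * (x ^ i * z * x ^ (-i))
        = y * x⁻¹ * (x * (x ^ i * z * x ^ (-i)) * x⁻¹) * x := by group
      _ = _ := by rw [h1]; group
  have hy' : ∀ i : ℤ, y⁻¹ * (x ^ i * z * x ^ (-i)) * y⁻¹⁻¹
      = x ^ (i - 1) * z * x ^ (-(i - 1)) := by
    intro i
    have h1 := hy (i - 1)
    rw [sub_add_cancel] at h1
    rw [← h1]; group
  have hstep : ∀ g : G, (∀ k ∈ K, g * k * g⁻¹ ∈ K) →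
      (∃ q : FreeGroup (Fin 2), FreeGroup.lift ![x, y] q = g) → ∀ v : G,
      (∃ k ∈ K, ∃ p : FreeGroup (Fin 2), v = k * FreeGroup.lift ![x, y] p) →
      ∃ k ∈ K, ∃ p : FreeGroup (Fin 2), g * v = k * FreeGroup.lift ![x, y] p := by
    rintro g hg ⟨q, hq⟩ _ ⟨k, hk, p, rfl⟩
    exact ⟨g * k * g⁻¹, hg k hk, q * p, by rw [map_mul, hq]; group⟩
  have hz : z ∈ K := by simpa using hmem 0
  induction hu using Subgroup.closure_induction_left with
  | one => exact ⟨1, one_mem _, 1, by simp⟩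
  | mul_left g hg v _ ih =>
    rcases hg with rfl | rfl | rfl
    · exact hstep _ (hconj _ fun i => by rw [hx]; exact hmem _) ⟨FreeGroup.of 0, by simp⟩ _ ih
    · exact hstep _ (hconj _ fun i => by rw [hy]; exact hmem _) ⟨FreeGroup.of 1, by simp⟩ _ ih
    · obtain ⟨k, hk, p, rfl⟩ := ih
      exact ⟨_, mul_mem hz hk, p, by group⟩
  | inv_mul_cancel g hg v _ ih =>
    rcases hg with rfl | rfl | rfl
    · exact hstep _ (hconj _ fun i => by rw [hx']; exact hmem _) ⟨(FreeGroup.of 0)⁻¹, by simp⟩ _ ih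
    · exact hstep _ (hconj _ fun i => by rw [hy']; exact hmem _) ⟨(FreeGroup.of 1)⁻¹, by simp⟩ _ ih
    · obtain ⟨k, hk, p, rfl⟩ := ih
      exact ⟨_, mul_mem (inv_mem hz) hk, p, by group⟩

end Structure

/-- A word which is trivial at `(x₀, x₁, 1)` equals a word in `a` and `c` in the limit group. -/
theorem exists_lift_ac {u : FreeGroup (Fin 3)} (hu : evalAt 1 u = 1) :
    ∃ v : FreeGroup (Fin 2), PresentedGroup.mk limitRels u
      = PresentedGroup.mk limitRels (FreeGroup.lift ![a, c] v) := by
  set π := PresentedGroup.mk limitRels with hπ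
  have hrel : ∀ r ∈ limitRels, π r = 1 := fun r hr => PresentedGroup.one_of_mem hr
  have hpair : ThompsonPair (π a) (π b) := by
    rw [thompsonPair_map_ab]
    exact ⟨hrel _ (by simp [limitRels]), hrel _ (by simp [limitRels])⟩
  have hcomm : ∀ i : ℤ, Commute (π b * (π a)⁻¹) ((π a) ^ i * π c * (π a) ^ (-i)) := by
    intro i
    have := hrel _ (Or.inr ⟨i, rfl⟩)
    simpa only [map_commutatorElement, commutatorElement_eq_one_iff_commute, map_mul, map_inv,
      map_zpow] using this
  have hone : ∀ r ∈ limitRels, evalAt 1 r = 1 := by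
    rintro r ((rfl | rfl | rfl | rfl) | ⟨i, rfl⟩)
    · exact (evalAt_R₁_R₂ _).1
    · exact (evalAt_R₁_R₂ _).2
    · simp [R₃, map_commutatorElement, evalAt_a, evalAt_c]
    · simp [R₄, map_commutatorElement, evalAt_a, evalAt_c]
    · simp [map_commutatorElement, evalAt_a, evalAt_c]
  -- The map killing `c` also kills `k`, so `p(x0, x1) = 1`; then `p(a, b) = 1` by rigidity, and
  -- only `k`, a word in `a` and `c`, remains.
  let ρ : PresentedGroup limitRels →* thompsonF := PresentedGroup.toGroup hone
  have hρ : ∀ v, ρ (π v) = evalAt 1 v := fun v => rfl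
  have hmem : π u ∈ Subgroup.closure {π a, π b, π c} := by
    have h1 : ({π a, π b, π c} : Set _) = Set.range (PresentedGroup.of (rels := limitRels)) := by
      ext g
      simp only [Set.mem_insert_iff, Set.mem_singleton_iff, Set.mem_range, Fin.exists_fin_succ]
      simp [eq_comm, hπ, a, b, c, PresentedGroup.of]
    rw [h1, PresentedGroup.closure_range_of]
    trivial
  obtain ⟨k, hk, p, hkp⟩ := exists_mul_of_commute hcomm hmem
  have hρk : ρ k = 1 := by
    have : Subgroup.closure (Set.range fun i : ℤ => (π a) ^ i * π c * (π a) ^ (-i)) ≤ ρ.ker := by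
      rw [Subgroup.closure_le]
      rintro _ ⟨i, rfl⟩
      simp [MonoidHom.mem_ker, hρ, evalAt_c]
    exact this hk
  have hp : evalF p = 1 := by
    have h1 := congrArg ρ hkp
    rw [hρ, hu, map_mul, hρk, one_mul, map_lift, hρ, hρ, evalAt_a, evalAt_b] at h1
    exact h1.symm
  rw [eq_one_of_evalF_eq_one hpair hp, mul_one] at hkp
  have hrange : k ∈ (FreeGroup.lift ![π a, π c]).range := by
    have : Subgroup.closure (Set.range fun i : ℤ => (π a) ^ i * π c * (π a) ^ (-i))
        ≤ (FreeGroup.lift ![π a, π c]).range := by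
      rw [Subgroup.closure_le]
      rintro _ ⟨i, rfl⟩
      exact ⟨FreeGroup.of 0 ^ i * FreeGroup.of 1 * FreeGroup.of 0 ^ (-i), by simp⟩
    exact this hk
  obtain ⟨v, hv⟩ := hrange
  exact ⟨v, by rw [hkp, ← hv, map_lift]⟩

/-! ### Convergence to the limit group. -/

theorem tendsto_groupOfWord {t : ℕ → ℝ} {w : ℕ → FreeGroup (Fin 2)}
    (ht : ∀ n, t n ∈ Set.Ico (0 : ℝ) 1) (hlim : Tendsto t atTop (𝓝 1))
    (hsupp : ∀ n, SupportedIn (evalF (w n)) (t n) 1)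
    (hlin : ∀ n, MapsLinearlyOnto (evalF (w n)) ((3 + t n) / 4) 1 ((1 + t n) / 2) 1) :
    Tendsto (fun n => groupOfWord (w n)) atTop (𝓝 limitGroup) := by
  have hhalf : ∀ᶠ n in atTop, 1 / 2 < t n := hlim.eventually_const_lt (by norm_num)
  have hpair : ∀ᶠ n in atTop, ThompsonPair x0 (evalF (w n)) := by
    filter_upwards [hhalf] with n hn
    exact thompsonPair_of_supportedIn hn.le (hsupp n) ((hlin n).eq_two_mul_sub (ht n))
  have hmoves : ∀ n, ∃ x, (evalF (w n)).1 x ≠ x := by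
    intro n
    obtain ⟨h0, h1⟩ := ht n
    refine ⟨⟨(3 + t n) / 4, by linarith, by linarith⟩, fun he => ?_⟩
    have h2 := (hlin n).eq_two_mul_sub (ht n) ⟨(3 + t n) / 4, by linarith, by linarith⟩ le_rfl
    rw [he] at h2
    change (3 + t n) / 4 = 2 * ((3 + t n) / 4) - 1 at h2
    linarith
  have hrel := eventually_relator_eq_one hlim hsupp hpair
  have hlimit : ∀ u ∈ Subgroup.normalClosure limitRels,
      ∀ᶠ n in atTop, evalAt (evalF (w n)) u = 1 :=
    fun u hu => eventually_mem_of_mem_normalClosure hrel hu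
  refine tendsto_of_eventually_relations fun u => ?_
  have hL : u ∈ limitGroup.relations ↔ u ∈ Subgroup.normalClosure limitRels := by
    rw [limitGroup, relations_markedPresentation, limitRels]
  simp only [mem_relations_groupOfWord, hL]
  by_cases hu : u ∈ Subgroup.normalClosure limitRels
  · exact (hlimit u hu).mono fun n hn => iff_of_true hn hu
  · suffices ∀ᶠ n in atTop, evalAt (evalF (w n)) u ≠ 1 from
      this.mono fun n hn => iff_of_false hn hu
    by_contra hfreq
    replace hfreq : ∃ᶠ n in atTop, evalAt (evalF (w n)) u = 1 := by
      simpa [Filter.Frequently] using hfreq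
    have hone : evalAt 1 u = 1 := by
      refine Subtype.ext (DFunLike.ext _ _ fun x => ?_)
      obtain ⟨n, h1, h2⟩ := (hfreq.and_eventually (eventually_evalAt_apply hlim hsupp u x)).exists
      rw [← h2, h1]
    obtain ⟨v, hv⟩ := exists_lift_ac hone
    have hvu : u⁻¹ * FreeGroup.lift ![a, c] v ∈ Subgroup.normalClosure limitRels := by
      rw [← PresentedGroup.mk_eq_one_iff, map_mul, map_inv, hv, inv_mul_cancel]
    -- One index is enough: there `u` and `u⁻¹ v(a, c)` are both trivial and `(x0, wₙ)` satisfies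
    -- the relations of `F`.
    obtain ⟨n, h1, ⟨h2, h3⟩, h4⟩ :=
      (hfreq.and_eventually (((hlimit _ hvu).and hhalf).and hpair)).exists
    have hv1 : FreeGroup.lift ![x0, evalF (w n)] v = 1 := by
      rw [map_mul, map_inv, h1, inv_one, one_mul, map_lift, evalAt_a, evalAt_c] at h2
      exact h2
    have hac : ThompsonPair (PresentedGroup.mk limitRels a) (PresentedGroup.mk limitRels c) := by
      rw [thompsonPair_map_ac]
      exact ⟨PresentedGroup.one_of_mem (by simp [limitRels]),
        PresentedGroup.one_of_mem (by simp [limitRels])⟩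
    have := eq_one_of_lift_x0_eq_one hac h4 (by linarith) (hsupp n) (hmoves n) hv1
    rw [← map_lift, ← hv, PresentedGroup.mk_eq_one_iff] at this
    exact hu this

end ThompsonLimit

theorem theorem4p3 :
    (∀ (t : ℕ → ℝ) (w : ℕ → FreeGroup (Fin 2)),
      (∀ n, t n ∈ Set.Ico (0 : ℝ) 1) →
      Tendsto t atTop (𝓝 1) →
      (∀ n, ThompsonLimit.SupportedIn (ThompsonLimit.evalF (w n)) (t n) 1) →
      (∀ n, ThompsonLimit.MapsLinearlyOnto (ThompsonLimit.evalF (w n))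
        ((3 + t n) / 4) 1 ((1 + t n) / 2) 1) →
      Tendsto (fun n => ThompsonLimit.groupOfWord (w n)) atTop (𝓝 ThompsonLimit.limitGroup)) ∧
    (∀ n : ℕ,
      ThompsonLimit.SupportedIn (ThompsonLimit.evalF (ThompsonLimit.xWord n))
        (1 - 1 / 2 ^ n) 1 ∧
      ThompsonLimit.MapsLinearlyOnto (ThompsonLimit.evalF (ThompsonLimit.xWord n))
        ((3 + (1 - 1 / 2 ^ n)) / 4) 1 ((1 + (1 - 1 / 2 ^ n)) / 2) 1) := by
  exact ⟨fun t w ht hlim hsupp hlin => ThompsonLimit.tendsto_groupOfWord ht hlim hsupp hlin,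
    fun n => ⟨(ThompsonLimit.xWord_spec n).1, ThompsonLimit.xWord_mapsLinearlyOnto n⟩⟩
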